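/- Let $\Omega\subset\mathbb{R}^2$ be a bounded polygonal domain (open, connected, with no slits or punctures, i.e. $\Omega=\operatorname{int}\overline\Omega$), let $\mathcal{T}_{h_0}$ be a conforming triangulation of $\Omega$ with mesh size $h_0$ (the largest diameter of a triangle), and for $h\in I=\{h_0/2^i : i=0,1,2,\dots\}$ let $\mathcal{T}_{h/2}$ be the Goursat refinement of $\mathcal{T}_h$ (each triangle is cut into four along the lines joining the midpoints of its edges). Let $\mathcal{V}_h$ be the space of functions that are continuous on $\overline\Omega$, affine on every $T\in\mathcal{T}_h$, and zero on $\partial\Omega$. Let $P_1^h,\dots,P_{N_h}^h$ be the nodes of $\mathcal{T}_h$ in $\Omega$, with nodal basis functions $\varphi_i^h\in\mathcal{V}_h$, $\varphi_i^h(P_j^h)=\delta_{ij}$, and let $\mathcal{I}_h f=\sum_{i=1}^{N_h} f(P_i^h)\varphi_i^h$ for $f\in C(\Omega)$. For functions $\rho, u$ put $\mathcal{D}_\rho u=\rho u$ and $\mathcal{D}^h_{\rho}u=\mathcal{I}_h(\rho u)$. A mesh $\mathcal{T}_h$ is called locally symmetric if for every node $P$ of $\mathcal{T}_h$ that lies in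 $\Omega$ the union of the triangles of $\mathcal{T}_h$ having $P$ as a corner is invariant under the reflection $x\mapsto 2P-x$. Let $\|\cdot\|$ be the norm of $L^2(\Omega)$, let $\|f\|_{\widetilde H^{-1}(\Omega)}=\sup\{|\int_\Omega f v| : v\in H_0^1(\Omega),\ \|v\|_{H^1(\Omega)}\le 1\}$ for $f\in L^2(\Omega)$, and for $p\in\{1,2\}$ let $\|\rho\|_{W^p_\infty(\Omega)/\mathbb{R}}=\max_{1\le|\alpha|\le p}\|\partial^\alpha\rho\|_{L^\infty(\Omega)}$. Then there is a constant $C>0$, depending only on $\Omega$ and $\mathcal{T}_{h_0}$, such that for every $\rho\in W^2_\infty(\Omega)$ (identified with its continuous representative on $\Omega$), every $h\in I$ and every $u\in\mathcal{V}_h$, with $\rho_h=\mathcal{I}_h\rho$, $$\|(\mathcal{D}_\rho-\mathcal{D}^h_{\rho_h})u\|_{\widetilde H^{-1}(\Omega)}\le C\,h^p\,\|\rho\|_{W^p_\infty(\Omega)/\mathbb{R}}\,\|u\|$$ holds with $p=1$, and also with $p=2$ whenever $\mathcal{T}_h$ is locally symmetric. -/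

import Mathlib

open MeasureTheory
open scoped ENNReal

namespace FEM

/-- The Euclidean plane. -/
abbrev Plane : Type := EuclideanSpace ℝ (Fin 2)

/-! ### Sobolev spaces on open subsets of the plane

Functions on `Ω` (or on its closure) are represented by functions on the whole plane; everything
below depends only on their restriction to `Ω` (or to its closure). -/

/-- Real test functions on `Ω`: smooth, with compact support contained in `Ω`. -/
def IsTestFunction (Ω : Set Plane) (φ : Plane → ℝ) : Prop :=
  ContDiff ℝ ((⊤ : ℕ∞) : WithTop ℕ∞) φ ∧ HasCompactSupport φ ∧ tsupport φ ⊆ Ω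

/-- The classical partial derivative in the `j`-th coordinate direction. -/
noncomputable def partialDeriv (j : Fin 2) (φ : Plane → ℝ) : Plane → ℝ :=
  fun x => fderiv ℝ φ x (EuclideanSpace.single j 1)

/-- The classical derivative `∂^α φ` for a multi-index `α = (α₁, α₂)`. -/
noncomputable def multiDeriv (α : ℕ × ℕ) (φ : Plane → ℝ) : Plane → ℝ :=
  (partialDeriv 0)^[α.1] ((partialDeriv 1)^[α.2] φ)

/-- `g` is the weak derivative `∂^α f` on `Ω`. -/
def HasWeakDeriv (Ω : Set Plane) (α : ℕ × ℕ) (f g : Plane → ℝ) : Prop :=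
  LocallyIntegrableOn f Ω ∧ LocallyIntegrableOn g Ω ∧
    ∀ φ : Plane → ℝ, IsTestFunction Ω φ →
      ∫ x in Ω, f x * multiDeriv α φ x = (-1) ^ (α.1 + α.2) * ∫ x in Ω, g x * φ x

open Classical in
/-- The weak derivative `∂^α f` on `Ω` (unique up to a null set), and `0` if there is none. -/
noncomputable def weakDeriv (Ω : Set Plane) (α : ℕ × ℕ) (f : Plane → ℝ) : Plane → ℝ :=
  if h : ∃ g, HasWeakDeriv Ω α f g then h.choose else 0

/-- Membership in the Sobolev space `W^m_q(Ω)`. -/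
def MemSobolev (Ω : Set Plane) (m : ℕ) (q : ℝ≥0∞) (f : Plane → ℝ) : Prop :=
  MemLp f q (volume.restrict Ω) ∧
    ∀ α : ℕ × ℕ, α.1 + α.2 ≤ m →
      ∃ g, HasWeakDeriv Ω α f g ∧ MemLp g q (volume.restrict Ω)

/-- The `L²(Ω)` norm. -/
noncomputable def normL2 (Ω : Set Plane) (f : Plane → ℝ) : ℝ≥0∞ :=
  eLpNorm f 2 (volume.restrict Ω)

/-- The norm `(∑_{|α| ≤ m} ‖∂^α f‖²)^{1/2}` of `H^m(Ω)`, for `f ∈ H^m(Ω)`. -/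
noncomputable def normH (Ω : Set Plane) (m : ℕ) (f : Plane → ℝ) : ℝ≥0∞ :=
  (∑ k ∈ Finset.range (m + 1), ∑ α ∈ Finset.HasAntidiagonal.antidiagonal k,
    normL2 Ω (weakDeriv Ω α f) ^ 2) ^ (1 / 2 : ℝ)

/-- `‖f‖_{W^m_∞(Ω)/ℝ} = max_{1 ≤ |α| ≤ m} ‖∂^α f‖_{L^∞(Ω)}`, for `f ∈ W^m_∞(Ω)`. -/
noncomputable def normWInftyModConst (Ω : Set Plane) (m : ℕ) (f : Plane → ℝ) : ℝ≥0∞ :=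
  ⨆ (α : ℕ × ℕ) (_ : 1 ≤ α.1 + α.2 ∧ α.1 + α.2 ≤ m),
    eLpNorm (weakDeriv Ω α f) ⊤ (volume.restrict Ω)

/-- Membership in `H¹₀(Ω)`, the closure of the test functions in `H¹(Ω)`. -/
def MemH10 (Ω : Set Plane) (v : Plane → ℝ) : Prop :=
  MemSobolev Ω 1 2 v ∧
    ∀ ε : ℝ≥0∞, 0 < ε → ∃ φ, IsTestFunction Ω φ ∧ normH Ω 1 (v - φ) < ε

/-- The norm of the dual (with respect to the `L²(Ω)` inner product) of
`H^m(Ω) ∩ H¹₀(Ω)`, evaluated at `f ∈ L²(Ω)`. -/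
noncomputable def normHNegTilde (Ω : Set Plane) (m : ℕ) (f : Plane → ℝ) : ℝ≥0∞ :=
  ⨆ (v : Plane → ℝ) (_ : MemSobolev Ω m 2 v ∧ MemH10 Ω v ∧ normH Ω m v ≤ 1),
    ENNReal.ofReal |∫ x in Ω, f x * v x|

/-! ### Polygonal domains and triangulations -/

/-- A bounded polygonal domain: bounded, open and connected, its boundary is a finite union of
line segments, and it has no slits or punctures. -/
structure IsPolygonalDomain (Ω : Set Plane) : Prop where
  isOpen : IsOpen Ω
  isConnected : IsConnected Ω
  isBounded : Bornology.IsBounded Ω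
  frontier_eq : ∃ S : Finset (Plane × Plane), frontier Ω = ⋃ e ∈ S, segment ℝ e.1 e.2
  interior_closure : interior (closure Ω) = Ω

/-- The closed triangle with vertex set `s`. -/
def triangle (s : Finset Plane) : Set Plane := convexHull ℝ (s : Set Plane)

open Classical in
/-- A conforming triangulation of `Ω`, each triangle being given by its set of vertices:
the triangles are nondegenerate, any two of them meet exactly in the convex hull of their common
vertices (a common edge, a common vertex, or nothing), and they cover the closure of `Ω`. -/
structure IsTriangulation (Ω : Set Plane) (T : Finset (Finset Plane)) : Prop where
  card_eq : ∀ s ∈ T, s.card = 3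
  affineIndependent : ∀ s ∈ T, AffineIndependent ℝ (fun p : s => (p : Plane))
  conforming : ∀ s ∈ T, ∀ t ∈ T, triangle s ∩ triangle t = triangle (s ∩ t)
  cover : ⋃ s ∈ T, triangle s = closure Ω

open Classical in
/-- Goursat refinement: every triangle is cut into the corner triangles
`{midpoint p q | q ∈ s}`, one for each of its vertices `p`, and the triangle formed by the
midpoints of its edges. -/
noncomputable def goursat (T : Finset (Finset Plane)) : Finset (Finset Plane) :=
  T.biUnion fun s =>
    insert (s.offDiag.image fun e => midpoint ℝ e.1 e.2)
      (s.image fun p => s.image fun q => midpoint ℝ p q)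

/-- The mesh obtained from `T₀` by `k` successive Goursat refinements. -/
noncomputable def mesh (T₀ : Finset (Finset Plane)) (k : ℕ) : Finset (Finset Plane) :=
  goursat^[k] T₀

/-- The mesh size of a mesh: the largest diameter of its triangles. -/
noncomputable def meshSize (T : Finset (Finset Plane)) : ℝ :=
  ⨆ s : {s // s ∈ T}, Metric.diam (triangle s.1)

open Classical in
/-- The nodes of the mesh that lie in the (open) domain `Ω`. -/
noncomputable def interiorNodes (Ω : Set Plane) (T : Finset (Finset Plane)) : Finset Plane :=
  (T.biUnion id).filter (· ∈ Ω)

/-- The union of the triangles having `P` as a corner. -/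
def star (T : Finset (Finset Plane)) (P : Plane) : Set Plane :=
  ⋃ s ∈ T, ⋃ (_ : P ∈ s), triangle s

/-- Local symmetry: for every interior node `P`, the union of the triangles having `P` as a corner
is invariant with respect to the reflection `x ↦ 2 P - x`. -/
def IsLocallySymmetric (Ω : Set Plane) (T : Finset (Finset Plane)) : Prop :=
  ∀ P ∈ interiorNodes Ω T, (fun x : Plane => (2 : ℝ) • P - x) '' star T P = star T P

/-! ### Continuous piecewise linear finite elements -/

/-- `u ∈ V_h`: `u` is continuous on the closure of `Ω`, (affine) linear on each triangle, and
vanishes on the boundary. -/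
def MemV (Ω : Set Plane) (T : Finset (Finset Plane)) (u : Plane → ℝ) : Prop :=
  ContinuousOn u (closure Ω) ∧
    (∀ s ∈ T, ∃ A : Plane →ᵃ[ℝ] ℝ, Set.EqOn u A (triangle s)) ∧
    ∀ x ∈ frontier Ω, u x = 0

open Classical in
/-- The barycentric coordinate of `x` with respect to the vertex `P` of the nondegenerate triangle
`s`; it is `0` if `P` is not a vertex of `s`. -/
noncomputable def baryCoord (s : Finset Plane) (P x : Plane) : ℝ :=
  if h : AffineIndependent ℝ (fun p : s => (p : Plane)) ∧
      affineSpan ℝ (Set.range (fun p : s => (p : Plane))) = ⊤ ∧ P ∈ s then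
    (AffineBasis.mk (fun p : s => (p : Plane)) h.1 h.2.1).coord ⟨P, h.2.2⟩ x
  else 0

open Classical in
/-- The nodal basis function `φ_P` of the mesh `T`: on each triangle it is the barycentric
coordinate with respect to `P`. On a conforming mesh the choice of the triangle containing `x`
is immaterial. -/
noncomputable def nodalBasis (T : Finset (Finset Plane)) (P x : Plane) : ℝ :=
  if h : ∃ s ∈ T, x ∈ triangle s then baryCoord h.choose P x else 0

/-- The interpolation operator `I_h f = ∑_i f(P_i) φ_i`, the sum being over the interior nodes. -/
noncomputable def interp (Ω : Set Plane) (T : Finset (Finset Plane)) (f : Plane → ℝ) :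
    Plane → ℝ :=
  fun x => ∑ P ∈ interiorNodes Ω T, f P * nodalBasis T P x

/-- The multiplication operator `D_ρ u = ρ u`. -/
def mulOp (ρ u : Plane → ℝ) : Plane → ℝ := fun x => ρ x * u x

/-- The discrete multiplication operator `D^h_ρ = I_h D_ρ`. -/
noncomputable def discreteMulOp (Ω : Set Plane) (T : Finset (Finset Plane)) (ρ u : Plane → ℝ) :
    Plane → ℝ :=
  interp Ω T (mulOp ρ u)

end FEM

/-! On the closure of Ω the error is e = Σ u(P) φ_P (ρ - ρ(P)), summed over the interior nodes P
(`mulError_eq`): u is expanded in the nodal basis, and the outer interpolation samples ρ_h only at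
interior nodes, where ρ_h = ρ. Let D bound the diameters of the triangles and let M be the seminorm
of ρ.

First order. On a triangle the nodal functions of its vertices are nonnegative with sum one, and
|ρ(x) - ρ(P)| ≤ 2M|x - P| along segments contained in Ω. Hence |e| ≤ 2MD times the largest vertex
value of |u|, and an inverse estimate for affine functions (`IsCell.exists_vertex_bound`) gives ‖e‖
≤ 16MD‖u‖. Testing against v with ‖v‖ ≤ 1 finishes the case p = 1.

Second order. Mollification gives a Taylor expansion ρ(x) = ρ(P) + L_P(x - P) + O(M|x - P|²), whose
remainder is treated as before. For the linear part, local symmetry makes φ_P even about P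
(`nodalBasis_reflect`) while L_P(x - P) is odd, so an integral against a test function φ only sees
φ(x) - φ(2P - x). On the square of half-side D about P the L² norm of this difference is at most √8
D times that of the gradient (`lintegral_sub_reflect_sq_le`). This is the second factor D. The nodes
are summed by Cauchy–Schwarz, using that the squares overlap boundedly often. A general v in H¹₀ is
first replaced by a test function φ with ‖v - φ‖ ≤ D. Being zero outside Ω, φ makes sense on squares
that protrude from Ω, and the replacement costs only ‖e‖ D, again of second order.

Uniformity in h. Children of a triangle are homothetic copies of ratio ±1/2, so D² divided by the
lower bound for the areas is the same on every level. Conformity is carried along as agreement of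
barycentric coordinates on intersections, which refinement preserves because the fine coordinates
are a universal function of the coarse ones (`baryCoord_child`). -/

namespace FEM

/-! ### Barycentric coordinates -/

/-- The vertex set of a nondegenerate triangle. -/
structure IsCell (s : Finset Plane) : Prop where
  card_eq : s.card = 3
  affineIndependent : AffineIndependent ℝ (fun p : s => (p : Plane))

theorem sum_triple {M : Type*} [AddCommMonoid M] {a b c : Plane} (hab : a ≠ b) (hac : a ≠ c)
    (hbc : b ≠ c) (f : Plane → M) (s : Finset Plane) (hs : ∀ x, x ∈ s ↔ x = a ∨ x = b ∨ x = c) :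
    ∑ x ∈ s, f x = f a + f b + f c := by
  classical
  have : s = {a, b, c} := by ext x; simp [hs]
  rw [this, Finset.sum_insert (by simp [hab, hac]), Finset.sum_insert (by simp [hbc]),
    Finset.sum_singleton, add_assoc]

namespace IsCell

variable {s : Finset Plane}

theorem affineSpan_eq_top (hs : IsCell s) :
    affineSpan ℝ (Set.range (fun p : s => (p : Plane))) = ⊤ := by
  rw [hs.affineIndependent.affineSpan_eq_top_iff_card_eq_finrank_add_one]
  simp [hs.card_eq]

/-- The vertices of a triangle as an affine basis. -/
noncomputable def basis (hs : IsCell s) : AffineBasis s ℝ Plane :=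
  AffineBasis.mk (fun p : s => (p : Plane)) hs.affineIndependent hs.affineSpan_eq_top

theorem basis_apply (hs : IsCell s) (p : s) : hs.basis p = (p : Plane) := rfl

theorem baryCoord_eq (hs : IsCell s) {P : Plane} (hP : P ∈ s) (x : Plane) :
    baryCoord s P x = hs.basis.coord ⟨P, hP⟩ x := by
  unfold baryCoord
  rw [dif_pos ⟨hs.affineIndependent, hs.affineSpan_eq_top, hP⟩]
  rfl

theorem sum_baryCoord (hs : IsCell s) (x : Plane) : ∑ P ∈ s, baryCoord s P x = 1 := by
  rw [← Finset.sum_coe_sort, ← hs.basis.sum_coord_apply_eq_one x]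
  exact Finset.sum_congr rfl fun P _ => hs.baryCoord_eq P.2 x

theorem sum_baryCoord_smul (hs : IsCell s) (x : Plane) : ∑ P ∈ s, baryCoord s P x • P = x := by
  rw [← Finset.sum_coe_sort]
  conv_rhs => rw [← hs.basis.linear_combination_coord_eq_self x]
  exact Finset.sum_congr rfl fun P _ => by rw [hs.baryCoord_eq P.2 x, hs.basis_apply]

theorem baryCoord_unique (hs : IsCell s) {x : Plane} {w : Plane → ℝ} (hw : ∑ P ∈ s, w P = 1)
    (hx : ∑ P ∈ s, w P • P = x) {P : Plane} (hP : P ∈ s) : baryCoord s P x = w P := by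
  rw [hs.baryCoord_eq hP, ← hx]
  have h1 : ∑ p : s, w p = 1 := by rw [Finset.sum_coe_sort s w, hw]
  have h2 := hs.basis.coord_apply_combination_of_mem (Finset.mem_univ ⟨P, hP⟩)
    (w := fun p : s => w p) h1
  rw [Finset.univ.affineCombination_eq_linear_combination _ _ h1] at h2
  rw [← h2, ← Finset.sum_coe_sort s (fun P => w P • P)]
  rfl

theorem mem_triangle (hs : IsCell s) {x : Plane} :
    x ∈ triangle s ↔ ∀ P ∈ s, 0 ≤ baryCoord s P x := by
  have h := hs.basis.convexHull_eq_nonneg_coord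
  have hr : Set.range hs.basis = (s : Set Plane) := by
    ext y; simp [hs.basis_apply]
  rw [hr] at h
  rw [triangle, h]
  constructor
  · intro hx P hP; rw [hs.baryCoord_eq hP]; exact hx _
  · intro hx P; rw [← hs.baryCoord_eq P.2]; exact hx _ P.2

end IsCell

theorem baryCoord_of_notMem {s : Finset Plane} {P : Plane} (hP : P ∉ s) (x : Plane) :
    baryCoord s P x = 0 := by
  unfold baryCoord
  rw [dif_neg]
  tauto

namespace IsCell

variable {s : Finset Plane}

theorem baryCoord_nonneg (hs : IsCell s) {x : Plane} (hx : x ∈ triangle s) (P : Plane) :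
    0 ≤ baryCoord s P x := by
  by_cases hP : P ∈ s
  · exact hs.mem_triangle.1 hx P hP
  · rw [baryCoord_of_notMem hP]

theorem baryCoord_le_one (hs : IsCell s) {x : Plane} (hx : x ∈ triangle s) (P : Plane) :
    baryCoord s P x ≤ 1 := by
  by_cases hP : P ∈ s
  · rw [← hs.sum_baryCoord x]
    exact Finset.single_le_sum (f := fun P => baryCoord s P x)
      (fun Q _ => hs.baryCoord_nonneg hx Q) hP
  · rw [baryCoord_of_notMem hP]; exact zero_le_one

theorem baryCoord_vertex [DecidableEq Plane] (hs : IsCell s) {Q : Plane} (hQ : Q ∈ s)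
    (P : Plane) : baryCoord s P Q = if P = Q then 1 else 0 := by
  by_cases hP : P ∈ s
  · exact hs.baryCoord_unique (w := fun P => if P = Q then 1 else 0) (by simp [hQ])
      (by simp [hQ]) hP
  · rw [baryCoord_of_notMem hP, if_neg]
    rintro rfl; exact hP hQ

theorem exists_affine (hs : IsCell s) (P : Plane) :
    ∃ A : Plane →ᵃ[ℝ] ℝ, ∀ x, baryCoord s P x = A x := by
  by_cases hP : P ∈ s
  · exact ⟨hs.basis.coord ⟨P, hP⟩, fun x => hs.baryCoord_eq hP x⟩
  · exact ⟨AffineMap.const ℝ Plane 0, fun x => by simp [baryCoord_of_notMem hP x]⟩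

theorem continuous_baryCoord (hs : IsCell s) (P : Plane) : Continuous (baryCoord s P) := by
  obtain ⟨A, hA⟩ := hs.exists_affine P
  rw [funext hA]
  exact A.continuous_of_finiteDimensional

theorem affine_apply (hs : IsCell s) (A : Plane →ᵃ[ℝ] ℝ) (x : Plane) :
    A x = ∑ P ∈ s, baryCoord s P x * A P := by
  have h (y : Plane) : A y = A.linear y + A 0 := by
    simpa using A.map_vadd 0 y
  have h1 : A.linear x = ∑ P ∈ s, baryCoord s P x * A.linear P := by
    conv_lhs => rw [← hs.sum_baryCoord_smul x]
    simp
  rw [h x, h1]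
  conv_rhs => enter [2, P]; rw [h P, mul_add]
  rw [Finset.sum_add_distrib, ← Finset.sum_mul, hs.sum_baryCoord, one_mul]

theorem baryCoord_lineMap (hs : IsCell s) (P x y : Plane) (r : ℝ) :
    baryCoord s P (x + r • (y - x)) = baryCoord s P x + r * (baryCoord s P y - baryCoord s P x) := by
  obtain ⟨A, hA⟩ := hs.exists_affine P
  simp only [hA]
  have h (y : Plane) : A y = A.linear y + A 0 := by
    simpa using A.map_vadd 0 y
  rw [h, h x, h y]
  simp; ring

theorem subset_triangle (s : Finset Plane) : (s : Set Plane) ⊆ triangle s :=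
  subset_convexHull ℝ _

theorem convex_triangle (s : Finset Plane) : Convex ℝ (triangle s) := convex_convexHull ℝ _

theorem isCompact_triangle (s : Finset Plane) : IsCompact (triangle s) :=
  s.finite_toSet.isCompact_convexHull ℝ

theorem nonempty_interior (hs : IsCell s) : (interior (triangle s)).Nonempty := by
  have := hs.affineSpan_eq_top
  rw [Subtype.range_coe_subtype] at this
  exact interior_convexHull_nonempty_iff_affineSpan_eq_top.2 this

theorem volume_pos (hs : IsCell s) : 0 < volume (triangle s) :=
  (isOpen_interior.measure_pos volume hs.nonempty_interior).trans_le
    (measure_mono interior_subset)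

theorem volume_lt_top (s : Finset Plane) : volume (triangle s) < ⊤ :=
  (isCompact_triangle s).measure_lt_top

theorem volume_interior (s : Finset Plane) : volume (interior (triangle s)) = volume (triangle s) :=
  measure_interior_of_null_frontier ((convex_triangle s).addHaar_frontier volume)

theorem exists_triple (hs : IsCell s) : ∃ a b c : Plane, a ≠ b ∧ a ≠ c ∧ b ≠ c ∧
    ∀ x, x ∈ s ↔ x = a ∨ x = b ∨ x = c := by
  classical
  obtain ⟨a, b, c, h1, h2, h3, rfl⟩ := Finset.card_eq_three.1 hs.card_eq
  exact ⟨a, b, c, h1, h2, h3, by simp⟩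

theorem dist_le (s : Finset Plane) {D : ℝ} (hD : ∀ P ∈ s, ∀ Q ∈ s, dist P Q ≤ D) {x y : Plane}
    (hx : x ∈ triangle s) (hy : y ∈ triangle s) : dist x y ≤ D := by
  obtain ⟨P, hP, Q, hQ, h⟩ := convexHull_exists_dist_ge2 hx hy
  exact h.trans (hD P hP Q hQ)

end IsCell

/-! ### Goursat refinement -/

/-- A triangulation whose barycentric coordinates agree on intersections of triangles, with
vertices of a triangle at distance at most `D` and triangles of area at least `a`. -/
structure IsMesh (Ω : Set Plane) (T : Finset (Finset Plane)) (D : ℝ) (a : ℝ≥0∞) : Prop where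
  isCell : ∀ s ∈ T, IsCell s
  coherent : ∀ s ∈ T, ∀ t ∈ T, ∀ x ∈ triangle s, x ∈ triangle t →
    ∀ P, baryCoord s P x = baryCoord t P x
  cover : ⋃ s ∈ T, triangle s = closure Ω
  dist_le : ∀ s ∈ T, ∀ P ∈ s, ∀ Q ∈ s, dist P Q ≤ D
  le_volume : ∀ s ∈ T, a ≤ volume (triangle s)

-- A common point is a convex combination of common vertices. Extended by zero, the weights are
-- admissible barycentric coordinates in both triangles, and uniqueness makes them equal. Conformity
-- is used only in this form from here on, since it passes easily to refinements.
open Classical in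
theorem IsTriangulation.coherent {Ω : Set Plane} {T : Finset (Finset Plane)}
    (hT : IsTriangulation Ω T) {s t : Finset Plane} (hs : s ∈ T) (ht : t ∈ T) {x : Plane}
    (hxs : x ∈ triangle s) (hxt : x ∈ triangle t) (P : Plane) :
    baryCoord s P x = baryCoord t P x := by
  have hx : x ∈ triangle (s ∩ t) := hT.conforming s hs t ht ▸ ⟨hxs, hxt⟩
  obtain ⟨w, -, hw1, hwx⟩ := Finset.mem_convexHull'.1 hx
  let w' : Plane → ℝ := fun Q => if Q ∈ s ∩ t then w Q else 0
  have key (r : Finset Plane) (hr : IsCell r) (hsub : s ∩ t ⊆ r) :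
      ∀ Q, baryCoord r Q x = w' Q := by
    intro Q
    by_cases hQ : Q ∈ r
    · refine hr.baryCoord_unique (w := w') ?_ ?_ hQ
      · rw [← hw1]
        refine (Finset.sum_subset hsub fun Q _ hQ => ?_).symm.trans
          (Finset.sum_congr rfl fun Q hQ => ?_)
        · simp only [w', if_neg hQ]
        · simp only [w', if_pos hQ]
      · conv_rhs => rw [← hwx]
        refine (Finset.sum_subset hsub fun Q _ hQ => ?_).symm.trans
          (Finset.sum_congr rfl fun Q hQ => ?_)
        · simp only [w', if_neg hQ, zero_smul]
        · simp only [w', if_pos hQ]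
    · rw [baryCoord_of_notMem hQ]
      exact (if_neg fun h => hQ (hsub h)).symm
  rw [key s ⟨hT.card_eq s hs, hT.affineIndependent s hs⟩ Finset.inter_subset_left,
    key t ⟨hT.card_eq t ht, hT.affineIndependent t ht⟩ Finset.inter_subset_right]

/-- `t` arises from the triangle with vertices `a, b, c` by cutting off the corner at `a`. -/
def IsCornerChild (a b c : Plane) (t : Finset Plane) : Prop :=
  ∀ x, x ∈ t ↔ x = a ∨ x = midpoint ℝ a b ∨ x = midpoint ℝ a c

/-- `t` consists of the midpoints of the edges of the triangle with vertices `a, b, c`. -/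
def IsMiddleChild (a b c : Plane) (t : Finset Plane) : Prop :=
  ∀ x, x ∈ t ↔ x = midpoint ℝ b c ∨ x = midpoint ℝ a c ∨ x = midpoint ℝ a b

theorem exists_parent {T : Finset (Finset Plane)} (hT : ∀ s ∈ T, IsCell s) {t : Finset Plane}
    (ht : t ∈ goursat T) : ∃ s ∈ T, ∃ a b c : Plane, a ≠ b ∧ a ≠ c ∧ b ≠ c ∧
      (∀ x, x ∈ s ↔ x = a ∨ x = b ∨ x = c) ∧ (IsCornerChild a b c t ∨ IsMiddleChild a b c t) := by
  classical
  simp only [goursat, Finset.mem_biUnion, Finset.mem_insert, Finset.mem_image] at ht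
  obtain ⟨s, hs, rfl | ⟨p, hp, rfl⟩⟩ := ht
  · obtain ⟨a, b, c, hab, hac, hbc, h⟩ := (hT s hs).exists_triple
    refine ⟨s, hs, a, b, c, hab, hac, hbc, h, Or.inr fun x => ?_⟩
    simp only [Finset.mem_image, Finset.mem_offDiag, Prod.exists, h]
    constructor
    · rintro ⟨p, q, ⟨rfl | rfl | rfl, rfl | rfl | rfl, hne⟩, rfl⟩ <;>
        simp_all [midpoint_comm]
    · rintro (rfl | rfl | rfl)
      · exact ⟨b, c, ⟨by simp, by simp, hbc⟩, rfl⟩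
      · exact ⟨a, c, ⟨by simp, by simp, hac⟩, rfl⟩
      · exact ⟨a, b, ⟨by simp, by simp, hab⟩, rfl⟩
  · have : ∃ a b c : Plane, a ≠ b ∧ a ≠ c ∧ b ≠ c ∧ (∀ x, x ∈ s ↔ x = a ∨ x = b ∨ x = c) ∧
        p = a := by
      obtain ⟨a, b, c, hab, hac, hbc, h⟩ := (hT s hs).exists_triple
      rcases (h p).1 hp with rfl | rfl | rfl
      · exact ⟨p, b, c, hab, hac, hbc, h, rfl⟩
      · exact ⟨p, a, c, hab.symm, hbc, hac, fun x => by rw [h]; tauto, rfl⟩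
      · exact ⟨p, a, b, hac.symm, hbc.symm, hab, fun x => by rw [h]; tauto, rfl⟩
    obtain ⟨a, b, c, hab, hac, hbc, h, rfl⟩ := this
    refine ⟨s, hs, p, b, c, hab, hac, hbc, h, Or.inl fun x => ?_⟩
    simp only [Finset.mem_image, h]
    constructor
    · rintro ⟨q, rfl | rfl | rfl, rfl⟩ <;> simp
    · rintro (rfl | rfl | rfl)
      · exact ⟨x, by simp⟩
      · exact ⟨b, by simp⟩
      · exact ⟨c, by simp⟩

theorem exists_cornerChild {T : Finset (Finset Plane)} {s : Finset Plane} (hs : s ∈ T)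
    {a b c : Plane} (h : ∀ x, x ∈ s ↔ x = a ∨ x = b ∨ x = c) :
    ∃ t ∈ goursat T, IsCornerChild a b c t := by
  classical
  refine ⟨s.image fun q => midpoint ℝ a q, ?_, fun x => ?_⟩
  · simp only [goursat, Finset.mem_biUnion, Finset.mem_insert, Finset.mem_image]
    exact ⟨s, hs, Or.inr ⟨a, by simp [h], rfl⟩⟩
  · simp only [Finset.mem_image, h]
    constructor
    · rintro ⟨q, rfl | rfl | rfl, rfl⟩ <;> simp
    · rintro (rfl | rfl | rfl)
      · exact ⟨x, by simp⟩
      · exact ⟨b, by simp⟩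
      · exact ⟨c, by simp⟩

theorem exists_middleChild {T : Finset (Finset Plane)} {s : Finset Plane} (hs : s ∈ T)
    {a b c : Plane} (hab : a ≠ b) (hac : a ≠ c) (hbc : b ≠ c)
    (h : ∀ x, x ∈ s ↔ x = a ∨ x = b ∨ x = c) :
    ∃ t ∈ goursat T, IsMiddleChild a b c t := by
  classical
  refine ⟨s.offDiag.image fun e => midpoint ℝ e.1 e.2, ?_, fun x => ?_⟩
  · simp only [goursat, Finset.mem_biUnion, Finset.mem_insert, Finset.mem_image]
    exact ⟨s, hs, Or.inl rfl⟩
  · simp only [Finset.mem_image, Finset.mem_offDiag, Prod.exists, h]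
    constructor
    · rintro ⟨p, q, ⟨rfl | rfl | rfl, rfl | rfl | rfl, hne⟩, rfl⟩ <;>
        simp_all [midpoint_comm]
    · rintro (rfl | rfl | rfl)
      · exact ⟨b, c, ⟨by simp, by simp, hbc⟩, rfl⟩
      · exact ⟨a, c, ⟨by simp, by simp, hac⟩, rfl⟩
      · exact ⟨a, b, ⟨by simp, by simp, hab⟩, rfl⟩

theorem midpoint_eq_half (a b : Plane) : midpoint ℝ a b = (1 / 2 : ℝ) • a + (1 / 2 : ℝ) • b := by
  rw [midpoint_eq_smul_add, invOf_eq_inv, smul_add]; norm_num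

/-- A child of a triangle is its image under a homothety of ratio `±1/2`. -/
theorem exists_homothety {s t : Finset Plane} {a b c : Plane}
    (h : ∀ x, x ∈ s ↔ x = a ∨ x = b ∨ x = c) (ht : IsCornerChild a b c t ∨ IsMiddleChild a b c t) :
    ∃ (p : Plane) (r : ℝ), |r| = 1 / 2 ∧ (t : Set Plane) = AffineMap.homothety p r '' s := by
  have hs : (s : Set Plane) = {a, b, c} := by ext x; simp [h]
  rcases ht with ht | ht
  · refine ⟨a, 1 / 2, by norm_num, ?_⟩
    have hts : (t : Set Plane) = {a, midpoint ℝ a b, midpoint ℝ a c} := by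
      ext x; simp [ht x]
    rw [hts, hs, Set.image_insert_eq, Set.image_pair]
    simp only [midpoint_eq_half, AffineMap.homothety_apply, vsub_eq_sub, vadd_eq_add, sub_self,
      smul_zero, zero_add]
    congr! 2
    · module
    · congr 1; module
  -- The centre is the barycentre: the homothety of ratio -1/2 about it sends each vertex to the
  -- midpoint of the opposite edge.
  · refine ⟨(1 / 3 : ℝ) • (a + b + c), -(1 / 2), by norm_num, ?_⟩
    have hts : (t : Set Plane) = {midpoint ℝ b c, midpoint ℝ a c, midpoint ℝ a b} := by
      ext x; simp [ht x]
    rw [hts, hs, Set.image_insert_eq, Set.image_pair]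
    simp only [midpoint_eq_half, AffineMap.homothety_apply, vsub_eq_sub, vadd_eq_add]
    have e (x y z : Plane) : -(1 / 2 : ℝ) • (x - (1 / 3 : ℝ) • (x + y + z)) +
        (1 / 3 : ℝ) • (x + y + z) = (1 / 2 : ℝ) • y + (1 / 2 : ℝ) • z := by module
    have e1 := e a b c
    have e2 := e b a c
    have e3 := e c a b
    rw [add_comm b a] at e2
    rw [add_assoc, add_comm c, ] at e3
    rw [e1, e2, e3]

theorem homothety_sub (p : Plane) (r : ℝ) (x y : Plane) :
    AffineMap.homothety p r x - AffineMap.homothety p r y = r • (x - y) := by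
  simp only [AffineMap.homothety_apply, vsub_eq_sub, vadd_eq_add]; module

theorem homothety_injective (p : Plane) {r : ℝ} (hr : r ≠ 0) :
    Function.Injective (AffineMap.homothety p r : Plane →ᵃ[ℝ] Plane) := by
  intro x y hxy
  have h := homothety_sub p r x y
  rw [hxy, sub_self] at h
  exact sub_eq_zero.1 ((smul_eq_zero.1 h.symm).resolve_left hr)

theorem triangle_homothety {s t : Finset Plane} {p : Plane} {r : ℝ}
    (h : (t : Set Plane) = AffineMap.homothety p r '' s) :
    triangle t = AffineMap.homothety p r '' triangle s := by
  rw [triangle, triangle, h, AffineMap.image_convexHull]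

theorem IsCell.homothety {s t : Finset Plane} (hs : IsCell s) {p : Plane} {r : ℝ} (hr : r ≠ 0)
    (h : (t : Set Plane) = AffineMap.homothety p r '' s) : IsCell t := by
  classical
  have hinj := homothety_injective p hr
  constructor
  · rw [← hs.card_eq, ← Set.ncard_coe_finset t, h, Set.ncard_image_of_injective _ hinj,
      Set.ncard_coe_finset]
  · have h1 := (hs.affineIndependent.map' (AffineMap.homothety p r) hinj).range
    have h2 : Set.range (⇑(AffineMap.homothety p r : Plane →ᵃ[ℝ] Plane) ∘
        fun q : s => (q : Plane)) = (t : Set Plane) := by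
      rw [h, Set.range_comp, Subtype.range_coe_subtype]; rfl
    rw [h2] at h1
    exact h1

theorem volume_homothety {s t : Finset Plane} {p : Plane} {r : ℝ}
    (h : (t : Set Plane) = AffineMap.homothety p r '' s) :
    volume (triangle t) = ENNReal.ofReal (r ^ 2) * volume (triangle s) := by
  rw [triangle_homothety h, Measure.addHaar_image_homothety]
  simp

/-! ### Fine barycentric coordinates as functions of the coarse ones -/

open Classical in
/-- The contribution of the pair `(A, B)` of nodes to the fine barycentric coordinate at the
midpoint of `A` and `B`, in terms of the coarse barycentric coordinates `l`. -/
noncomputable def subdivWeight (l : Plane → ℝ) (A B : Plane) : ℝ :=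
  if A = B then max (2 * l A - 1) 0
  else (1 / 2) * max (min (min (2 * l A) (2 * l B)) (2 * (l A + l B) - 1)) 0

open Classical in
/-- The fine barycentric coordinate at `Q` in terms of the coarse barycentric coordinates `l`. -/
noncomputable def subdivCoord (N : Finset Plane) (l : Plane → ℝ) (Q : Plane) : ℝ :=
  ∑ A ∈ N, ∑ B ∈ N, if midpoint ℝ A B = Q then subdivWeight l A B else 0

theorem subdivWeight_left {l : Plane → ℝ} {A : Plane} (h : l A = 0) (B : Plane) :
    subdivWeight l A B = 0 := by
  unfold subdivWeight
  split_ifs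
  · rw [h]; norm_num
  · rw [max_eq_right, mul_zero]
    exact (min_le_left _ _).trans ((min_le_left _ _).trans (by rw [h, mul_zero]))

theorem subdivWeight_right {l : Plane → ℝ} {B : Plane} (h : l B = 0) (A : Plane) :
    subdivWeight l A B = 0 := by
  unfold subdivWeight
  split_ifs with hAB
  · rw [hAB, h]; norm_num
  · rw [max_eq_right, mul_zero]
    exact (min_le_left _ _).trans ((min_le_right _ _).trans (by rw [h, mul_zero]))

/-- Pairs containing a node outside `s` have weight zero. Taking `N` to be all nodes of the mesh
removes the dependence of the formula on the parent triangle. -/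
theorem subdivCoord_subset {s N : Finset Plane} (hsN : s ⊆ N) {l : Plane → ℝ}
    (hl : ∀ P, P ∉ s → l P = 0) (Q : Plane) : subdivCoord N l Q = subdivCoord s l Q := by
  unfold subdivCoord
  refine (Finset.sum_subset hsN fun A _ hA => ?_).symm.trans (Finset.sum_congr rfl fun A _ => ?_)
  · refine Finset.sum_eq_zero fun B _ => ?_
    rw [subdivWeight_left (hl A hA), ite_self]
  · refine (Finset.sum_subset hsN fun B _ hB => ?_).symm
    rw [subdivWeight_right (hl B hB), ite_self]

theorem midpoint_ne {a b c : Plane} (h : b ≠ c) : midpoint ℝ a b ≠ midpoint ℝ a c := by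
  rw [midpoint_eq_half, midpoint_eq_half]
  intro h1
  refine h ?_
  have := add_left_cancel h1
  exact smul_right_injective _ (by norm_num : (1 / 2 : ℝ) ≠ 0) this

section Children

variable {s t : Finset Plane} {a b c : Plane}

theorem baryCoord_eq_sum_ite [DecidableEq Plane] (t : Finset Plane) (Q x : Plane) :
    baryCoord t Q x = ∑ R ∈ t, if R = Q then baryCoord t R x else 0 := by
  rw [Finset.sum_ite_eq']
  split_ifs with h
  · rfl
  · exact baryCoord_of_notMem h x

/-- The point of the formula is that its right side does not mention the child. With coarse
coordinates l, the corner child at a has coordinates 2l_a - 1, 2l_b, 2l_c, and the middle child has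
2(l_a + l_b) - 1 at the midpoint of a and b. The truncated minimum in `subdivWeight` selects the
correct value in each case and vanishes at the midpoint that is not a vertex of the child. Its
factor 1/2 compensates for the two orders of a pair in the double sum. The proof expresses l through
the fine weights m1, m2, m3 and evaluates. -/
theorem baryCoord_child (hs : IsCell s) (hab : a ≠ b) (hac : a ≠ c) (hbc : b ≠ c)
    (h : ∀ x, x ∈ s ↔ x = a ∨ x = b ∨ x = c) (hts : IsCornerChild a b c t ∨ IsMiddleChild a b c t)
    (ht : IsCell t) {x : Plane} (hx : x ∈ triangle t) (Q : Plane) :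
    baryCoord t Q x = subdivCoord s (fun P => baryCoord s P x) Q := by
  classical
  have hsum := sum_triple (M := ℝ) hab hac hbc
  rw [baryCoord_eq_sum_ite, subdivCoord]
  simp only [hsum _ s h, midpoint_self]
  rw [midpoint_comm b a, midpoint_comm c a, midpoint_comm c b]
  have nn := ht.baryCoord_nonneg hx
  have h1 := ht.sum_baryCoord x
  have h2 := ht.sum_baryCoord_smul x
  rcases hts with hts | hts
  · have n1 : a ≠ midpoint ℝ a b := by simpa using midpoint_ne (a := a) hab
    have n2 : a ≠ midpoint ℝ a c := by simpa using midpoint_ne (a := a) hac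
    have n3 := midpoint_ne (a := a) hbc
    rw [sum_triple n1 n2 n3 _ t hts] at h1 h2
    rw [sum_triple n1 n2 n3 _ t hts]
    have p1 := nn a
    have p2 := nn (midpoint ℝ a b)
    have p3 := nn (midpoint ℝ a c)
    generalize hm1 : baryCoord t a x = m1 at *
    generalize hm2 : baryCoord t (midpoint ℝ a b) x = m2 at *
    generalize hm3 : baryCoord t (midpoint ℝ a c) x = m3 at *
    let w : Plane → ℝ := fun P => if P = a then m1 + m2 / 2 + m3 / 2 else if P = b then m2 / 2 else
      m3 / 2
    have wa : w a = m1 + m2 / 2 + m3 / 2 := if_pos rfl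
    have wb : w b = m2 / 2 := by simp [w, hab.symm]
    have wc : w c = m3 / 2 := by simp [w, hac.symm, hbc.symm]
    have hw1 : ∑ P ∈ s, w P = 1 := by
      rw [hsum w s h, wa, wb, wc]; linarith
    have hw2 : ∑ P ∈ s, w P • P = x := by
      rw [sum_triple hab hac hbc _ s h, wa, wb, wc, ← h2, midpoint_eq_half, midpoint_eq_half]
      module
    have la := (hs.baryCoord_unique hw1 hw2 ((h a).2 (by simp))).trans wa
    have lb := (hs.baryCoord_unique hw1 hw2 ((h b).2 (by simp))).trans wb
    have lc := (hs.baryCoord_unique hw1 hw2 ((h c).2 (by simp))).trans wc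
    simp only [subdivWeight, if_pos, hab, hac, hbc, hab.symm, hac.symm, hbc.symm, if_false, la, lb,
      lc]
    have waa : max (2 * (m1 + m2 / 2 + m3 / 2) - 1) 0 = m1 := by
      rw [max_eq_left] <;> linarith
    have wbb : max (2 * (m2 / 2) - 1) 0 = 0 := by rw [max_eq_right]; linarith
    have wcc : max (2 * (m3 / 2) - 1) 0 = 0 := by rw [max_eq_right]; linarith
    have wab : max (min (min (2 * (m1 + m2 / 2 + m3 / 2)) (2 * (m2 / 2)))
        (2 * (m1 + m2 / 2 + m3 / 2 + m2 / 2) - 1)) 0 = m2 := by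
      rw [min_eq_right (b := 2 * (m2 / 2)), min_eq_left, max_eq_left] <;> linarith
    have wac : max (min (min (2 * (m1 + m2 / 2 + m3 / 2)) (2 * (m3 / 2)))
        (2 * (m1 + m2 / 2 + m3 / 2 + m3 / 2) - 1)) 0 = m3 := by
      rw [min_eq_right (b := 2 * (m3 / 2)), min_eq_left, max_eq_left] <;> linarith
    have wbc : max (min (min (2 * (m2 / 2)) (2 * (m3 / 2)))
        (2 * (m2 / 2 + m3 / 2) - 1)) 0 = 0 := by
      rw [max_eq_right]
      exact (min_le_right _ _).trans (by linarith)
    rw [min_comm (2 * (m2 / 2)) (2 * (m1 + m2 / 2 + m3 / 2)),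
      min_comm (2 * (m3 / 2)) (2 * (m1 + m2 / 2 + m3 / 2)),
      min_comm (2 * (m3 / 2)) (2 * (m2 / 2)), add_comm (m2 / 2) (m1 + m2 / 2 + m3 / 2),
      add_comm (m3 / 2) (m1 + m2 / 2 + m3 / 2), add_comm (m3 / 2) (m2 / 2),
      waa, wbb, wcc, wab, wac, wbc]
    split_ifs <;> ring
  · have n1 : midpoint ℝ b c ≠ midpoint ℝ a c := by
      rw [midpoint_comm b, midpoint_comm a]; exact midpoint_ne hab.symm
    have n2 : midpoint ℝ b c ≠ midpoint ℝ a b := by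
      rw [midpoint_comm a]; exact midpoint_ne hac.symm
    have n3 := midpoint_ne (a := a) hbc.symm
    rw [sum_triple n1 n2 n3 _ t hts] at h1 h2
    rw [sum_triple n1 n2 n3 _ t hts]
    have p1 := nn (midpoint ℝ b c)
    have p2 := nn (midpoint ℝ a c)
    have p3 := nn (midpoint ℝ a b)
    generalize hm1 : baryCoord t (midpoint ℝ b c) x = m1 at *
    generalize hm2 : baryCoord t (midpoint ℝ a c) x = m2 at *
    generalize hm3 : baryCoord t (midpoint ℝ a b) x = m3 at *
    let w : Plane → ℝ := fun P => if P = a then m2 / 2 + m3 / 2 else if P = b then m1 / 2 + m3 / 2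
      else m1 / 2 + m2 / 2
    have wa : w a = m2 / 2 + m3 / 2 := if_pos rfl
    have wb : w b = m1 / 2 + m3 / 2 := by simp [w, hab.symm]
    have wc : w c = m1 / 2 + m2 / 2 := by simp [w, hac.symm, hbc.symm]
    have hw1 : ∑ P ∈ s, w P = 1 := by
      rw [hsum w s h, wa, wb, wc]; linarith
    have hw2 : ∑ P ∈ s, w P • P = x := by
      rw [sum_triple hab hac hbc _ s h, wa, wb, wc, ← h2, midpoint_eq_half, midpoint_eq_half,
        midpoint_eq_half]
      module
    have la := (hs.baryCoord_unique hw1 hw2 ((h a).2 (by simp))).trans wa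
    have lb := (hs.baryCoord_unique hw1 hw2 ((h b).2 (by simp))).trans wb
    have lc := (hs.baryCoord_unique hw1 hw2 ((h c).2 (by simp))).trans wc
    simp only [subdivWeight, if_pos, hab, hac, hbc, hab.symm, hac.symm, hbc.symm, if_false, la, lb,
      lc]
    have wnode (p q : ℝ) (hp : p + q ≤ 1) : max (2 * (p / 2 + q / 2) - 1) 0 = 0 := by
      rw [max_eq_right]; linarith
    have wedge (p q r : ℝ) (hp : 0 ≤ p) (hq : 0 ≤ q) (hr : 0 ≤ r) (hpqr : p + q + r = 1)
        (u v : ℝ) (hu : u = p / 2 + r / 2) (hv : v = q / 2 + r / 2) :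
        max (min (min (2 * u) (2 * v)) (2 * (u + v) - 1)) 0 = r := by
      subst hu hv
      rw [min_eq_right, max_eq_left]
      · linarith
      · linarith
      · exact le_min (by linarith) (by linarith)
    rw [wnode m2 m3 (by linarith), wnode m1 m3 (by linarith), wnode m1 m2 (by linarith),
      wedge m2 m1 m3 p2 p1 p3 (by linarith) _ _ rfl rfl,
      wedge m1 m2 m3 p1 p2 p3 (by linarith) _ _ rfl rfl,
      wedge m3 m1 m2 p3 p1 p2 (by linarith) (m2 / 2 + m3 / 2) _ (by ring) rfl,
      wedge m1 m3 m2 p1 p3 p2 (by linarith) _ (m2 / 2 + m3 / 2) rfl (by ring),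
      wedge m3 m2 m1 p3 p2 p1 (by linarith) (m1 / 2 + m3 / 2) (m1 / 2 + m2 / 2) (by ring) (by ring),
      wedge m2 m3 m1 p2 p3 p1 (by linarith) (m1 / 2 + m2 / 2) (m1 / 2 + m3 / 2) (by ring) (by ring)]
    split_ifs <;> ring

theorem child_subset (h : ∀ x, x ∈ s ↔ x = a ∨ x = b ∨ x = c)
    (hts : IsCornerChild a b c t ∨ IsMiddleChild a b c t) : triangle t ⊆ triangle s := by
  refine convexHull_min (fun x hx => ?_) (convex_convexHull ℝ _)
  have ha : a ∈ triangle s := IsCell.subset_triangle s ((h a).2 (by simp))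
  have hb : b ∈ triangle s := IsCell.subset_triangle s ((h b).2 (by simp))
  have hc : c ∈ triangle s := IsCell.subset_triangle s ((h c).2 (by simp))
  have hm {p q : Plane} (hp : p ∈ triangle s) (hq : q ∈ triangle s) :
      midpoint ℝ p q ∈ triangle s := Convex.midpoint_mem (convex_convexHull ℝ _) hp hq
  rcases hts with hts | hts
  · rcases (hts x).1 hx with rfl | rfl | rfl
    exacts [ha, hm ha hb, hm ha hc]
  · rcases (hts x).1 hx with rfl | rfl | rfl
    exacts [hm hb hc, hm ha hc, hm ha hb]

theorem mem_cornerChild (hs : IsCell s) (hab : a ≠ b) (hac : a ≠ c) (hbc : b ≠ c)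
    (h : ∀ x, x ∈ s ↔ x = a ∨ x = b ∨ x = c) (hts : IsCornerChild a b c t) {x : Plane}
    (hx : x ∈ triangle s) (hxa : 1 / 2 ≤ baryCoord s a x) : x ∈ triangle t := by
  have h1 := hs.sum_baryCoord x
  have h2 := hs.sum_baryCoord_smul x
  rw [sum_triple hab hac hbc _ s h] at h1 h2
  have hb := hs.baryCoord_nonneg hx b
  have hc := hs.baryCoord_nonneg hx c
  have n1 : a ≠ midpoint ℝ a b := by simpa using midpoint_ne (a := a) hab
  have n2 : a ≠ midpoint ℝ a c := by simpa using midpoint_ne (a := a) hac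
  have n3 := midpoint_ne (a := a) hbc
  -- The weights are the coordinates of `x` in the child; the first is nonnegative because of `hxa`.
  have hx' : x = (2 * baryCoord s a x - 1) • a + (2 * baryCoord s b x) • midpoint ℝ a b +
      (2 * baryCoord s c x) • midpoint ℝ a c := by
    conv_lhs => rw [← h2]
    rw [midpoint_eq_half, midpoint_eq_half]
    have : baryCoord s c x = 1 - baryCoord s a x - baryCoord s b x := by linarith
    rw [this]
    module
  rw [hx']
  have hm (p : Plane) (hp : p = a ∨ p = midpoint ℝ a b ∨ p = midpoint ℝ a c) : p ∈ triangle t :=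
    IsCell.subset_triangle t ((hts p).2 hp)
  have hmem := Convex.sum_mem (convex_convexHull ℝ (t : Set Plane))
    (t := Finset.univ) (w := ![2 * baryCoord s a x - 1, 2 * baryCoord s b x, 2 * baryCoord s c x])
    (z := ![a, midpoint ℝ a b, midpoint ℝ a c]) ?_ ?_ ?_
  · simpa [Fin.sum_univ_three, triangle] using hmem
  · intro i _; fin_cases i <;> simp <;> linarith
  · simp [Fin.sum_univ_three]; linarith
  · intro i _; fin_cases i <;> exact hm _ (by simp)

theorem mem_middleChild (hs : IsCell s) (hab : a ≠ b) (hac : a ≠ c) (hbc : b ≠ c)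
    (h : ∀ x, x ∈ s ↔ x = a ∨ x = b ∨ x = c) (hts : IsMiddleChild a b c t) {x : Plane}
    (hx : ∀ P ∈ s, baryCoord s P x ≤ 1 / 2) : x ∈ triangle t := by
  have h1 := hs.sum_baryCoord x
  have h2 := hs.sum_baryCoord_smul x
  rw [sum_triple hab hac hbc _ s h] at h1 h2
  have ha := hx a ((h a).2 (by simp))
  have hb := hx b ((h b).2 (by simp))
  have hc := hx c ((h c).2 (by simp))
  have hx' : x = (1 - 2 * baryCoord s a x) • midpoint ℝ b c +
      (1 - 2 * baryCoord s b x) • midpoint ℝ a c + (1 - 2 * baryCoord s c x) • midpoint ℝ a b := by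
    conv_lhs => rw [← h2]
    rw [midpoint_eq_half, midpoint_eq_half, midpoint_eq_half]
    have : baryCoord s c x = 1 - baryCoord s a x - baryCoord s b x := by linarith
    rw [this]
    module
  rw [hx']
  have hm (p : Plane) (hp : p = midpoint ℝ b c ∨ p = midpoint ℝ a c ∨ p = midpoint ℝ a b) :
      p ∈ triangle t := IsCell.subset_triangle t ((hts p).2 hp)
  have hmem := Convex.sum_mem (convex_convexHull ℝ (t : Set Plane))
    (t := Finset.univ) (w := ![1 - 2 * baryCoord s a x, 1 - 2 * baryCoord s b x,
      1 - 2 * baryCoord s c x])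
    (z := ![midpoint ℝ b c, midpoint ℝ a c, midpoint ℝ a b]) ?_ ?_ ?_
  · simpa [Fin.sum_univ_three, triangle] using hmem
  · intro i _; fin_cases i <;> simp <;> linarith
  · simp [Fin.sum_univ_three]; linarith
  · intro i _; fin_cases i <;> exact hm _ (by simp)

end Children

theorem exists_child {T : Finset (Finset Plane)} {s : Finset Plane} (hs : IsCell s) (hsT : s ∈ T)
    {x : Plane} (hx : x ∈ triangle s) : ∃ t ∈ goursat T, x ∈ triangle t := by
  obtain ⟨a, b, c, hab, hac, hbc, h⟩ := hs.exists_triple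
  by_cases ha : 1 / 2 ≤ baryCoord s a x
  · obtain ⟨t, ht, hc⟩ := exists_cornerChild hsT h
    exact ⟨t, ht, mem_cornerChild hs hab hac hbc h hc hx ha⟩
  by_cases hb : 1 / 2 ≤ baryCoord s b x
  · have h' : ∀ x, x ∈ s ↔ x = b ∨ x = a ∨ x = c := fun x => by rw [h]; tauto
    obtain ⟨t, ht, hc⟩ := exists_cornerChild hsT h'
    exact ⟨t, ht, mem_cornerChild hs hab.symm hbc hac h' hc hx hb⟩
  by_cases hc : 1 / 2 ≤ baryCoord s c x
  · have h' : ∀ x, x ∈ s ↔ x = c ∨ x = a ∨ x = b := fun x => by rw [h]; tauto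
    obtain ⟨t, ht, hc'⟩ := exists_cornerChild hsT h'
    exact ⟨t, ht, mem_cornerChild hs hac.symm hbc.symm hab h' hc' hx hc⟩
  obtain ⟨t, ht, hm⟩ := exists_middleChild hsT hab hac hbc h
  refine ⟨t, ht, mem_middleChild hs hab hac hbc h hm fun P hP => ?_⟩
  rcases (h P).1 hP with rfl | rfl | rfl <;> linarith

/-- At a point common to two children the coarse coordinates agree by coherence of `T`, and the fine
ones are the same function of them. The homothety of ratio ±1/2 halves distances and quarters areas,
so `D ^ 2` and `a` scale alike. -/
theorem IsMesh.goursat {Ω : Set Plane} {T : Finset (Finset Plane)} {D : ℝ} {a : ℝ≥0∞}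
    (hT : IsMesh Ω T D a) : IsMesh Ω (goursat T) (D / 2) (a / 4) := by
  classical
  have hcell : ∀ t ∈ FEM.goursat T, IsCell t := by
    intro t ht
    obtain ⟨s, hs, a, b, c, -, -, -, h, hc⟩ := exists_parent hT.isCell ht
    obtain ⟨p, r, hr, hi⟩ := exists_homothety h hc
    exact (hT.isCell s hs).homothety (by rintro rfl; norm_num at hr) hi
  have hcoord : ∀ t ∈ FEM.goursat T, ∃ s ∈ T, triangle t ⊆ triangle s ∧ ∀ x ∈ triangle t, ∀ Q,
      baryCoord t Q x = subdivCoord (T.biUnion id) (fun P => baryCoord s P x) Q := by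
    intro t ht
    obtain ⟨s, hs, a, b, c, hab, hac, hbc, h, hc⟩ := exists_parent hT.isCell ht
    refine ⟨s, hs, child_subset h hc, fun x hx Q => ?_⟩
    rw [baryCoord_child (hT.isCell s hs) hab hac hbc h hc (hcell t ht) hx Q]
    exact (subdivCoord_subset (Finset.subset_biUnion_of_mem id hs)
      (fun P hP => baryCoord_of_notMem hP x) Q).symm
  refine ⟨hcell, ?_, ?_, ?_, ?_⟩
  · intro t₁ h₁ t₂ h₂ x hx₁ hx₂ Q
    obtain ⟨s₁, hs₁, hsub₁, hc₁⟩ := hcoord t₁ h₁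
    obtain ⟨s₂, hs₂, hsub₂, hc₂⟩ := hcoord t₂ h₂
    rw [hc₁ x hx₁, hc₂ x hx₂]
    congr 1
    funext P
    exact hT.coherent s₁ hs₁ s₂ hs₂ x (hsub₁ hx₁) (hsub₂ hx₂) P
  · rw [← hT.cover]
    refine subset_antisymm (Set.iUnion₂_subset fun t ht => ?_) (Set.iUnion₂_subset fun s hs x hx => ?_)
    · obtain ⟨s, hs, hsub, -⟩ := hcoord t ht
      exact hsub.trans (Set.subset_biUnion_of_mem (u := fun s => triangle s) hs)
    · obtain ⟨t, ht, hxt⟩ := exists_child (hT.isCell s hs) hs hx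
      exact Set.mem_biUnion ht hxt
  · intro t ht P hP Q hQ
    obtain ⟨s, hs, a, b, c, -, -, -, h, hc⟩ := exists_parent hT.isCell ht
    obtain ⟨p, r, hr, hi⟩ := exists_homothety h hc
    have hP' : P ∈ (t : Set Plane) := hP
    have hQ' : Q ∈ (t : Set Plane) := hQ
    rw [hi] at hP' hQ'
    obtain ⟨P', hP'', rfl⟩ := hP'
    obtain ⟨Q', hQ'', rfl⟩ := hQ'
    rw [dist_eq_norm, homothety_sub, norm_smul, Real.norm_eq_abs, hr, ← dist_eq_norm]
    linarith [hT.dist_le s hs P' hP'' Q' hQ'']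
  · intro t ht
    obtain ⟨s, hs, a', b, c, -, -, -, h, hc⟩ := exists_parent hT.isCell ht
    obtain ⟨p, r, hr, hi⟩ := exists_homothety h hc
    rw [volume_homothety hi, ← sq_abs, hr, ENNReal.div_eq_inv_mul]
    refine mul_le_mul' ?_ (hT.le_volume s hs)
    rw [show ((1 / 2 : ℝ) ^ 2) = 4⁻¹ by norm_num, ENNReal.ofReal_inv_of_pos (by norm_num)]
    norm_num

theorem IsMesh.mesh {Ω : Set Plane} {T : Finset (Finset Plane)} {D : ℝ} {a : ℝ≥0∞}
    (hT : IsMesh Ω T D a) (k : ℕ) : IsMesh Ω (mesh T k) (D / 2 ^ k) (a / 4 ^ k) := by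
  induction k with
  | zero => simpa [FEM.mesh] using hT
  | succ k ih =>
    have := ih.goursat
    rw [FEM.mesh, Function.iterate_succ_apply', pow_succ, pow_succ, ← div_div]
    convert! this using 1
    rw [ENNReal.div_eq_inv_mul, ENNReal.div_eq_inv_mul, ENNReal.div_eq_inv_mul,
      ENNReal.mul_inv (by simp) (by simp)]
    ring

theorem dist_le_meshSize {T : Finset (Finset Plane)} {s : Finset Plane} (hs : s ∈ T) {P Q : Plane}
    (hP : P ∈ s) (hQ : Q ∈ s) : dist P Q ≤ meshSize T := by
  have h1 : dist P Q ≤ Metric.diam (triangle s) :=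
    Metric.dist_le_diam_of_mem (IsCell.isCompact_triangle s).isBounded
      (IsCell.subset_triangle s hP) (IsCell.subset_triangle s hQ)
  exact h1.trans (le_ciSup (f := fun s : {s // s ∈ T} => Metric.diam (triangle s.1))
    (Set.finite_range _).bddAbove ⟨s, hs⟩)

theorem IsTriangulation.isMesh {Ω : Set Plane} {T : Finset (Finset Plane)}
    (hT : IsTriangulation Ω T) : ∃ a : ℝ, 0 < a ∧ IsMesh Ω T (meshSize T) (ENNReal.ofReal a) := by
  have hc : ∀ s ∈ T, IsCell s := fun s hs => ⟨hT.card_eq s hs, hT.affineIndependent s hs⟩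
  have : ∃ a : ℝ, 0 < a ∧ ∀ s ∈ T, ENNReal.ofReal a ≤ volume (triangle s) := by
    rcases T.eq_empty_or_nonempty with rfl | hne
    · exact ⟨1, one_pos, by simp⟩
    · obtain ⟨s₀, hs₀, hmin⟩ := T.exists_min_image (fun s => volume (triangle s)) hne
      refine ⟨(volume (triangle s₀)).toReal, ENNReal.toReal_pos (hc s₀ hs₀).volume_pos.ne'
        (IsCell.volume_lt_top s₀).ne, fun s hs => ?_⟩
      rw [ENNReal.ofReal_toReal (IsCell.volume_lt_top s₀).ne]
      exact hmin s hs
  obtain ⟨a, ha, hvol⟩ := this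
  exact ⟨a, ha, hc, fun s hs t ht x hxs hxt P => hT.coherent hs ht hxs hxt P, hT.cover,
    fun s hs P hP Q hQ => dist_le_meshSize hs hP hQ, hvol⟩

/-! ### A Poincaré type inequality for point reflections -/

theorem sq_lintegral_mul_le {α : Type*} [MeasurableSpace α] {μ : Measure α} {f g : α → ℝ≥0∞}
    (hf : AEMeasurable f μ) (hg : AEMeasurable g μ) :
    (∫⁻ x, f x * g x ∂μ) ^ 2 ≤ (∫⁻ x, f x ^ 2 ∂μ) * ∫⁻ x, g x ^ 2 ∂μ := by
  have h := ENNReal.lintegral_mul_le_Lp_mul_Lq μ Real.HolderConjugate.two_two hf hg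
  calc (∫⁻ x, f x * g x ∂μ) ^ 2
      ≤ ((∫⁻ x, f x ^ (2 : ℝ) ∂μ) ^ (1 / 2 : ℝ) * (∫⁻ x, g x ^ (2 : ℝ) ∂μ) ^ (1 / 2 : ℝ)) ^ 2 := by
        gcongr; exact h
    _ = _ := by
        rw [mul_pow, ← ENNReal.rpow_mul_natCast, ← ENNReal.rpow_mul_natCast]
        norm_num

theorem add_sq_le_two_mul (a b : ℝ≥0∞) : (a + b) ^ 2 ≤ 2 * (a ^ 2 + b ^ 2) := by
  have h := ENNReal.rpow_add_le_mul_rpow_add_rpow a b (p := 2) (by norm_num)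
  norm_num at h
  exact h

/-- The difference is the integral of `f'` over [-t, t]. The length 2h of the large interval enters
twice: through Cauchy–Schwarz and through the final integration of a bound that is constant in t. -/
theorem lintegral_sub_neg_sq_le {f : ℝ → ℝ} (hf : ContDiff ℝ 1 f) {h : ℝ} (hh : 0 ≤ h) :
    ∫⁻ t in Set.Icc (-h) h, ‖f t - f (-t)‖ₑ ^ 2 ≤
      ENNReal.ofReal (4 * h ^ 2) * ∫⁻ t in Set.Icc (-h) h, ‖deriv f t‖ₑ ^ 2 := by
  have hc : Continuous (deriv f) := hf.continuous_deriv le_rfl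
  have hvol : volume (Set.Icc (-h) h) = ENNReal.ofReal (2 * h) := by
    rw [Real.volume_Icc]; congr 1; ring
  have key : ∀ t ∈ Set.Icc (-h) h, ‖f t - f (-t)‖ₑ ^ 2 ≤
      ENNReal.ofReal (2 * h) * ∫⁻ t in Set.Icc (-h) h, ‖deriv f t‖ₑ ^ 2 := by
    intro t ht
    have h1 : f t - f (-t) = ∫ s in (-t)..t, deriv f s := by
      rw [intervalIntegral.integral_deriv_eq_sub]
      · exact fun x _ => (hf.differentiable one_ne_zero) x
      · exact hc.intervalIntegrable _ _
    have hsub : Set.uIoc (-t) t ⊆ Set.Icc (-h) h := by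
      intro s hs
      rw [Set.mem_uIoc] at hs
      obtain ⟨h1, h2⟩ := ht
      rcases hs with ⟨h3, h4⟩ | ⟨h3, h4⟩ <;> constructor <;> linarith
    have h2 : ‖f t - f (-t)‖ₑ ≤ ∫⁻ s in Set.Icc (-h) h, 1 * ‖deriv f s‖ₑ := by
      rw [h1, ← ofReal_norm, intervalIntegral.norm_intervalIntegral_eq,
        ofReal_norm]
      refine (enorm_integral_le_lintegral_enorm _).trans ?_
      simp only [one_mul]
      exact lintegral_mono_set hsub
    refine (pow_le_pow_left' h2 2).trans ((sq_lintegral_mul_le aemeasurable_const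
      hc.measurable.enorm.aemeasurable).trans ?_)
    simp [hvol]
  calc ∫⁻ t in Set.Icc (-h) h, ‖f t - f (-t)‖ₑ ^ 2
      ≤ ∫⁻ _ in Set.Icc (-h) h,
          ENNReal.ofReal (2 * h) * ∫⁻ t in Set.Icc (-h) h, ‖deriv f t‖ₑ ^ 2 :=
        setLIntegral_mono' measurableSet_Icc key
    _ = _ := by
        rw [setLIntegral_const, hvol, mul_comm _ (ENNReal.ofReal (2 * h)), ← mul_assoc,
          ← ENNReal.ofReal_mul (by positivity)]
        congr 2; ring

/-! ### Coordinates on a square and the two-dimensional reflection estimate -/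

/-- The coordinate chart centred at `P`. -/
noncomputable def chart (P : Plane) (z : ℝ × ℝ) : Plane := P + !₂[z.1, z.2]

theorem measurePreserving_chart (P : Plane) : MeasurePreserving (chart P) := by
  have h1 := (volume_preserving_finTwoArrow ℝ).symm
  have h2 := (PiLp.volume_preserving_toLp (Fin 2))
  have h3 := measurePreserving_add_left (volume : Measure Plane) P
  have h := (h3.comp h2).comp h1
  convert! h using 1

theorem measurableEmbedding_chart (P : Plane) : MeasurableEmbedding (chart P) := by
  have h1 := (MeasurableEquiv.finTwoArrow (α := ℝ)).symm.measurableEmbedding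
  have h2 := (MeasurableEquiv.toLp 2 (Fin 2 → ℝ)).measurableEmbedding
  have h3 := (MeasurableEquiv.addLeft P).measurableEmbedding
  have h := (h3.comp h2).comp h1
  convert! h using 1

theorem reflect_chart (P : Plane) (a b : ℝ) :
    (2 : ℝ) • P - chart P (a, b) = chart P (-a, -b) := by
  ext i
  fin_cases i <;> simp [chart] <;> ring

/-- The closed square with centre `P` and side length `2 * h`. -/
def square (P : Plane) (h : ℝ) : Set Plane := {x | ∀ i, |x i - P i| ≤ h}

theorem chart_preimage_square (P : Plane) (h : ℝ) :
    chart P ⁻¹' square P h = Set.Icc (-h) h ×ˢ Set.Icc (-h) h := by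
  ext ⟨a, b⟩
  simp only [chart, square, Fin.forall_fin_two, abs_le, Set.preimage_ofPred_eq, Set.mem_ofPred_eq,
    PiLp.add_apply, Matrix.cons_val_zero, Matrix.cons_val_one, add_sub_cancel_left,
    Set.mem_prod, Set.mem_Icc]

theorem setLIntegral_square (P : Plane) (h : ℝ) {F : Plane → ℝ≥0∞} (hF : Measurable F) :
    ∫⁻ x in square P h, F x =
      ∫⁻ a in Set.Icc (-h) h, ∫⁻ b in Set.Icc (-h) h, F (chart P (a, b)) := by
  have hm : Measurable fun z => F (chart P z) := hF.comp (measurableEmbedding_chart P).measurable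
  rw [← (measurePreserving_chart P).setLIntegral_comp_preimage_emb (measurableEmbedding_chart P),
    chart_preimage_square, Measure.volume_eq_prod, ← Measure.prod_restrict,
    lintegral_prod _ hm.aemeasurable]

theorem setLIntegral_square' (P : Plane) (h : ℝ) {F : Plane → ℝ≥0∞} (hF : Measurable F) :
    ∫⁻ x in square P h, F x =
      ∫⁻ b in Set.Icc (-h) h, ∫⁻ a in Set.Icc (-h) h, F (chart P (a, b)) := by
  have hm : Measurable fun z => F (chart P z) := hF.comp (measurableEmbedding_chart P).measurable
  rw [setLIntegral_square P h hF, lintegral_lintegral_swap]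
  exact hm.aemeasurable

theorem setLIntegral_Icc_neg (h : ℝ) (G : ℝ → ℝ≥0∞) :
    ∫⁻ a in Set.Icc (-h) h, G (-a) = ∫⁻ a in Set.Icc (-h) h, G a := by
  have := (Measure.measurePreserving_neg (volume : Measure ℝ)).setLIntegral_comp_preimage_emb
    (MeasurableEquiv.neg ℝ).measurableEmbedding G (Set.Icc (-h) h)
  rw [← this]
  congr 2
  ext x; simp [and_comm]

theorem chart_line₀ (P : Plane) (a b : ℝ) :
    chart P (a, b) = chart P (0, b) + a • EuclideanSpace.single 0 (1 : ℝ) := by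
  ext i; fin_cases i <;> simp [chart]

theorem chart_line₁ (P : Plane) (a b : ℝ) :
    chart P (a, b) = chart P (a, 0) + b • EuclideanSpace.single 1 (1 : ℝ) := by
  ext i; fin_cases i <;> simp [chart]

theorem deriv_comp_line {v : Plane → ℝ} (hv : ContDiff ℝ 1 v) (q e : Plane) (t : ℝ) :
    deriv (fun t : ℝ => v (q + t • e)) t = fderiv ℝ v (q + t • e) e := by
  have h1 : HasDerivAt (fun t : ℝ => q + t • e) e t := by
    simpa using ((hasDerivAt_id t).smul_const e).const_add q
  exact (((hv.differentiable one_ne_zero) _).hasFDerivAt.comp_hasDerivAt t h1).deriv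

theorem continuous_partialDeriv {v : Plane → ℝ} (hv : ContDiff ℝ 1 v) (j : Fin 2) :
    Continuous (partialDeriv j v) :=
  (hv.continuous_fderiv one_ne_zero).clm_apply continuous_const

theorem lintegral_lintegral_two_mul_add {μ : Measure ℝ} [SFinite μ] {F G : ℝ × ℝ → ℝ≥0∞}
    (hF : Measurable F) (hG : Measurable G) :
    ∫⁻ a, ∫⁻ b, 2 * (F (a, b) + G (a, b)) ∂μ ∂μ =
      2 * ((∫⁻ a, ∫⁻ b, F (a, b) ∂μ ∂μ) + ∫⁻ a, ∫⁻ b, G (a, b) ∂μ ∂μ) := by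
  rw [← lintegral_prod _ hF.aemeasurable, ← lintegral_prod _ hG.aemeasurable,
    ← lintegral_prod (fun z => 2 * (F z + G z)) (by fun_prop), ← lintegral_add_left hF]
  exact lintegral_const_mul _ (hF.add hG)

/-- The reflection in `P` changes one coordinate sign after the other, and each step is the
one-dimensional estimate on the sections of the square, which are symmetric intervals. The
inequality (a + b)² ≤ 2(a² + b²) doubles the constant 4. -/
theorem lintegral_sub_reflect_sq_le {v : Plane → ℝ} (hv : ContDiff ℝ 1 v) (P : Plane) {h : ℝ}
    (hh : 0 ≤ h) :
    ∫⁻ x in square P h, ‖v x - v ((2 : ℝ) • P - x)‖ₑ ^ 2 ≤ ENNReal.ofReal (8 * h ^ 2) *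
      ∫⁻ x in square P h, (‖partialDeriv 0 v x‖ₑ ^ 2 + ‖partialDeriv 1 v x‖ₑ ^ 2) := by
  have hvc := hv.continuous
  have m0 : Measurable fun x => ‖partialDeriv 0 v x‖ₑ ^ 2 :=
    (continuous_partialDeriv hv 0).measurable.enorm.pow_const 2
  have m1 : Measurable fun x => ‖partialDeriv 1 v x‖ₑ ^ 2 :=
    (continuous_partialDeriv hv 1).measurable.enorm.pow_const 2
  have hch : Continuous (chart P) := by unfold chart; fun_prop
  have hL : Measurable fun x => ‖v x - v ((2 : ℝ) • P - x)‖ₑ ^ 2 :=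
    (by fun_prop : Continuous fun x => v x - v ((2 : ℝ) • P - x)).measurable.enorm.pow_const 2
  have c1 : Continuous fun z : ℝ × ℝ => v (chart P (z.1, z.2)) - v (chart P (-z.1, z.2)) := by
    fun_prop
  have c2 : Continuous fun z : ℝ × ℝ => v (chart P (-z.1, z.2)) - v (chart P (-z.1, -z.2)) := by
    fun_prop
  have n1 : Measurable fun z : ℝ × ℝ => ‖v (chart P (z.1, z.2)) - v (chart P (-z.1, z.2))‖ₑ ^ 2 :=
    c1.measurable.enorm.pow_const 2
  have n2 : Measurable fun z : ℝ × ℝ =>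
      ‖v (chart P (-z.1, z.2)) - v (chart P (-z.1, -z.2))‖ₑ ^ 2 :=
    c2.measurable.enorm.pow_const 2
  have e1 : ∫⁻ a in Set.Icc (-h) h, ∫⁻ b in Set.Icc (-h) h,
      ‖v (chart P (a, b)) - v (chart P (-a, b))‖ₑ ^ 2 ≤
      ENNReal.ofReal (4 * h ^ 2) * ∫⁻ x in square P h, ‖partialDeriv 0 v x‖ₑ ^ 2 := by
    rw [lintegral_lintegral_swap n1.aemeasurable, setLIntegral_square' P h m0,
      ← lintegral_const_mul' _ _ ENNReal.ofReal_ne_top]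
    refine lintegral_mono fun b => ?_
    have := lintegral_sub_neg_sq_le
      (f := fun t => v (chart P (0, b) + t • EuclideanSpace.single 0 (1 : ℝ)))
      (hv.comp (by fun_prop)) hh
    simp only [deriv_comp_line hv] at this
    simp only [← chart_line₀] at this
    exact this
  have e2 : ∫⁻ a in Set.Icc (-h) h, ∫⁻ b in Set.Icc (-h) h,
      ‖v (chart P (-a, b)) - v (chart P (-a, -b))‖ₑ ^ 2 ≤
      ENNReal.ofReal (4 * h ^ 2) * ∫⁻ x in square P h, ‖partialDeriv 1 v x‖ₑ ^ 2 := by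
    -- The first sign is already changed here; substituting -a for a in the outer integral undoes
    -- it.
    rw [setLIntegral_Icc_neg h (fun a => ∫⁻ b in Set.Icc (-h) h,
      ‖v (chart P (a, b)) - v (chart P (a, -b))‖ₑ ^ 2), setLIntegral_square P h m1,
      ← lintegral_const_mul' _ _ ENNReal.ofReal_ne_top]
    refine lintegral_mono fun a => ?_
    have := lintegral_sub_neg_sq_le
      (f := fun t => v (chart P (a, 0) + t • EuclideanSpace.single 1 (1 : ℝ)))
      (hv.comp (by fun_prop)) hh
    simp only [deriv_comp_line hv] at this
    simp only [← chart_line₁] at this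
    exact this
  rw [lintegral_add_left m0, mul_add, setLIntegral_square P h hL]
  simp only [reflect_chart]
  calc ∫⁻ a in Set.Icc (-h) h, ∫⁻ b in Set.Icc (-h) h,
        ‖v (chart P (a, b)) - v (chart P (-a, -b))‖ₑ ^ 2
      ≤ ∫⁻ a in Set.Icc (-h) h, ∫⁻ b in Set.Icc (-h) h,
        2 * (‖v (chart P (a, b)) - v (chart P (-a, b))‖ₑ ^ 2 +
          ‖v (chart P (-a, b)) - v (chart P (-a, -b))‖ₑ ^ 2) := by
        refine lintegral_mono fun a => lintegral_mono fun b => ?_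
        refine le_trans ?_ (add_sq_le_two_mul _ _)
        gcongr
        rw [show v (chart P (a, b)) - v (chart P (-a, -b)) =
          (v (chart P (a, b)) - v (chart P (-a, b))) +
          (v (chart P (-a, b)) - v (chart P (-a, -b))) by ring]
        exact enorm_add_le _ _
    _ = 2 * ((∫⁻ a in Set.Icc (-h) h, ∫⁻ b in Set.Icc (-h) h,
        ‖v (chart P (a, b)) - v (chart P (-a, b))‖ₑ ^ 2) +
        ∫⁻ a in Set.Icc (-h) h, ∫⁻ b in Set.Icc (-h) h,
          ‖v (chart P (-a, b)) - v (chart P (-a, -b))‖ₑ ^ 2) := by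
        exact lintegral_lintegral_two_mul_add n1 n2
    _ ≤ 2 * (ENNReal.ofReal (4 * h ^ 2) * (∫⁻ x in square P h, ‖partialDeriv 0 v x‖ₑ ^ 2) +
        ENNReal.ofReal (4 * h ^ 2) * ∫⁻ x in square P h, ‖partialDeriv 1 v x‖ₑ ^ 2) := by
        gcongr
    _ = _ := by
        rw [show 8 * h ^ 2 = 2 * (4 * h ^ 2) by ring, ENNReal.ofReal_mul (p := 2) (by norm_num)]
        simp only [ENNReal.ofReal_ofNat]
        ring

/-! ### Weak derivatives and test functions -/

theorem contDiff_partialDeriv {k : Plane → ℝ} (hk : ContDiff ℝ ((⊤ : ℕ∞) : WithTop ℕ∞) k)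
    (j : Fin 2) : ContDiff ℝ ((⊤ : ℕ∞) : WithTop ℕ∞) (partialDeriv j k) :=
  (hk.fderiv_right (m := ((⊤ : ℕ∞) : WithTop ℕ∞)) (by simp)).clm_apply contDiff_const

theorem tsupport_partialDeriv_subset (k : Plane → ℝ) (j : Fin 2) :
    tsupport (partialDeriv j k) ⊆ tsupport k := by
  refine closure_minimal (fun x hx => ?_) (isClosed_tsupport k)
  refine support_fderiv_subset ℝ (f := k) fun h => hx ?_
  simp [partialDeriv, h]

theorem IsTestFunction.partialDeriv {Ω : Set Plane} {k : Plane → ℝ} (hk : IsTestFunction Ω k)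
    (j : Fin 2) : IsTestFunction Ω (partialDeriv j k) :=
  have hsub := tsupport_partialDeriv_subset k j
  ⟨contDiff_partialDeriv hk.1 j, hk.2.1.of_isClosed_subset (isClosed_tsupport _) hsub,
    hsub.trans hk.2.2⟩

theorem IsTestFunction.iterate_partialDeriv {Ω : Set Plane} {k : Plane → ℝ}
    (hk : IsTestFunction Ω k) (j : Fin 2) (n : ℕ) :
    IsTestFunction Ω ((FEM.partialDeriv j)^[n] k) := by
  induction n with
  | zero => exact hk
  | succ n ih => rw [Function.iterate_succ_apply']; exact ih.partialDeriv j

theorem IsTestFunction.multiDeriv {Ω : Set Plane} {k : Plane → ℝ}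
    (hk : IsTestFunction Ω k) (α : ℕ × ℕ) : IsTestFunction Ω (multiDeriv α k) :=
  (hk.iterate_partialDeriv 1 α.2).iterate_partialDeriv 0 α.1

theorem IsTestFunction.contDiff_one {Ω : Set Plane} {k : Plane → ℝ}
    (hk : IsTestFunction Ω k) : ContDiff ℝ 1 k := hk.1.of_le (by exact_mod_cast le_top)

theorem IsTestFunction.continuous {Ω : Set Plane} {k : Plane → ℝ}
    (hk : IsTestFunction Ω k) : Continuous k := hk.1.continuous

theorem IsTestFunction.memLp {Ω : Set Plane} {k : Plane → ℝ}
    (hk : IsTestFunction Ω k) (p : ℝ≥0∞) : MemLp k p :=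
  hk.continuous.memLp_of_hasCompactSupport hk.2.1

theorem IsTestFunction.eq_zero {Ω : Set Plane} {k : Plane → ℝ}
    (hk : IsTestFunction Ω k) {x : Plane} (hx : x ∉ Ω) : k x = 0 :=
  image_eq_zero_of_notMem_tsupport fun h => hx (hk.2.2 h)

theorem IsTestFunction.setIntegral_mul_eq {Ω : Set Plane} {k : Plane → ℝ}
    (hk : IsTestFunction Ω k) (f : Plane → ℝ) : ∫ x in Ω, f x * k x = ∫ x, f x * k x :=
  setIntegral_eq_integral_of_forall_compl_eq_zero fun x hx => by rw [hk.eq_zero hx, mul_zero]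

theorem IsTestFunction.integrableOn_mul {Ω : Set Plane} {k : Plane → ℝ}
    (hk : IsTestFunction Ω k) {f : Plane → ℝ} (hf : LocallyIntegrableOn f Ω) :
    IntegrableOn (fun x => f x * k x) Ω := by
  have h1 : IntegrableOn f (tsupport k) := hf.integrableOn_compact_subset hk.2.2 hk.2.1
  have h2 : IntegrableOn (fun x => f x * k x) (tsupport k) :=
    h1.mul_continuousOn hk.continuous.continuousOn hk.2.1
  refine IntegrableOn.mono_set ?_ (Set.subset_univ Ω)
  rw [integrableOn_univ]
  refine (integrableOn_iff_integrable_of_support_subset fun x hx => ?_).1 h2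
  exact subset_tsupport k fun h => hx (by simp [h])

/-- By the fundamental lemma of the calculus of variations. It makes the choice in `weakDeriv`
immaterial for every norm. -/
theorem HasWeakDeriv.ae_eq {Ω : Set Plane} (hΩ : IsOpen Ω) {α : ℕ × ℕ} {f g g' : Plane → ℝ}
    (h : HasWeakDeriv Ω α f g) (h' : HasWeakDeriv Ω α f g') : g =ᵐ[volume.restrict Ω] g' := by
  have := hΩ.ae_eq_zero_of_integral_contDiff_smul_eq_zero (h.2.1.sub h'.2.1) fun φ h1 h2 h3 => ?_
  · rw [Filter.EventuallyEq, ae_restrict_iff' hΩ.measurableSet]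
    filter_upwards [this] with x hx hxΩ
    exact sub_eq_zero.1 (hx hxΩ)
  · have hφ : IsTestFunction Ω φ := ⟨h1, h2, h3⟩
    have e := (h.2.2 φ hφ).symm.trans (h'.2.2 φ hφ)
    have e' := mul_left_cancel₀ (pow_ne_zero _ (by norm_num)) e
    have := integral_sub (hφ.integrableOn_mul h.2.1) (hφ.integrableOn_mul h'.2.1)
    rw [e', sub_self] at this
    rw [← this, ← setIntegral_eq_integral_of_forall_compl_eq_zero (s := Ω)]
    · refine integral_congr_ae (Filter.Eventually.of_forall fun x => ?_)
      simp; ring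
    · intro x hx; rw [hφ.eq_zero hx, zero_smul]

theorem HasWeakDeriv.weakDeriv {Ω : Set Plane} {α : ℕ × ℕ} {f g : Plane → ℝ}
    (h : HasWeakDeriv Ω α f g) : HasWeakDeriv Ω α f (weakDeriv Ω α f) := by
  have h' : ∃ g, HasWeakDeriv Ω α f g := ⟨g, h⟩
  unfold FEM.weakDeriv
  rw [dif_pos h']
  exact h'.choose_spec

theorem HasWeakDeriv.weakDeriv_ae_eq {Ω : Set Plane} (hΩ : IsOpen Ω) {α : ℕ × ℕ}
    {f g : Plane → ℝ} (h : HasWeakDeriv Ω α f g) :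
    FEM.weakDeriv Ω α f =ᵐ[volume.restrict Ω] g :=
  h.weakDeriv.ae_eq hΩ h

theorem HasWeakDeriv.sub {Ω : Set Plane} {α : ℕ × ℕ} {f₁ f₂ g₁ g₂ : Plane → ℝ}
    (h₁ : HasWeakDeriv Ω α f₁ g₁) (h₂ : HasWeakDeriv Ω α f₂ g₂) :
    HasWeakDeriv Ω α (f₁ - f₂) (g₁ - g₂) := by
  refine ⟨h₁.1.sub h₂.1, h₁.2.1.sub h₂.2.1, fun φ hφ => ?_⟩
  simp only [Pi.sub_apply, sub_mul]
  rw [integral_sub ((hφ.multiDeriv α).integrableOn_mul h₁.1)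
    ((hφ.multiDeriv α).integrableOn_mul h₂.1), integral_sub (hφ.integrableOn_mul h₁.2.1)
    (hφ.integrableOn_mul h₂.2.1), h₁.2.2 φ hφ, h₂.2.2 φ hφ, mul_sub]

theorem hasWeakDeriv_zero {Ω : Set Plane} {f : Plane → ℝ} (hf : LocallyIntegrableOn f Ω) :
    HasWeakDeriv Ω (0, 0) f f :=
  ⟨hf, hf, fun φ _ => by simp [multiDeriv]⟩

theorem IsTestFunction.locallyIntegrableOn {Ω : Set Plane} {k : Plane → ℝ}
    (hk : IsTestFunction Ω k) : LocallyIntegrableOn k Ω :=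
  hk.continuous.locallyIntegrable.locallyIntegrableOn Ω

theorem IsTestFunction.integral_mul_partialDeriv {Ω : Set Plane} {k φ : Plane → ℝ}
    (hk : IsTestFunction Ω k) (hφ : IsTestFunction Ω φ) (j : Fin 2) :
    ∫ x in Ω, k x * FEM.partialDeriv j φ x = - ∫ x in Ω, FEM.partialDeriv j k x * φ x := by
  rw [(hφ.partialDeriv j).setIntegral_mul_eq, hφ.setIntegral_mul_eq]
  have int {u w : Plane → ℝ} (hu : IsTestFunction Ω u) (hw : IsTestFunction Ω w) :
      Integrable fun x => u x * w x :=
    (hu.continuous.mul hw.continuous).integrable_of_hasCompactSupport hw.2.1.mul_left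
  exact integral_mul_fderiv_eq_neg_fderiv_mul_of_integrable (int (hk.partialDeriv j) hφ)
    (int hk (hφ.partialDeriv j)) (int hk hφ)
    (fun x _ => hk.contDiff_one.differentiable one_ne_zero x)
    (fun x _ => hφ.contDiff_one.differentiable one_ne_zero x)

theorem IsTestFunction.hasWeakDeriv_fst {Ω : Set Plane} {k : Plane → ℝ}
    (hk : IsTestFunction Ω k) : HasWeakDeriv Ω (1, 0) k (FEM.partialDeriv 0 k) :=
  ⟨hk.locallyIntegrableOn, (hk.partialDeriv 0).locallyIntegrableOn, fun φ hφ => by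
    simpa [FEM.multiDeriv] using hk.integral_mul_partialDeriv hφ 0⟩

theorem IsTestFunction.hasWeakDeriv_snd {Ω : Set Plane} {k : Plane → ℝ}
    (hk : IsTestFunction Ω k) : HasWeakDeriv Ω (0, 1) k (FEM.partialDeriv 1 k) :=
  ⟨hk.locallyIntegrableOn, (hk.partialDeriv 1).locallyIntegrableOn, fun φ hφ => by
    simpa [FEM.multiDeriv] using hk.integral_mul_partialDeriv hφ 1⟩

theorem normL2_weakDeriv_le_normH {Ω : Set Plane} {α : ℕ × ℕ} {m : ℕ} (hα : α.1 + α.2 ≤ m)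
    (f : Plane → ℝ) : normL2 Ω (weakDeriv Ω α f) ≤ normH Ω m f := by
  have h1 : normL2 Ω (weakDeriv Ω α f) ^ 2 ≤
      ∑ k ∈ Finset.range (m + 1), ∑ α ∈ Finset.HasAntidiagonal.antidiagonal k,
        normL2 Ω (weakDeriv Ω α f) ^ 2 := by
    refine le_trans ?_ (Finset.single_le_sum (f := fun k =>
      ∑ α ∈ Finset.HasAntidiagonal.antidiagonal k, normL2 Ω (weakDeriv Ω α f) ^ 2)
      (fun _ _ => zero_le) (Finset.mem_range.2 (Nat.lt_succ_of_le hα)))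
    exact Finset.single_le_sum (f := fun α => normL2 Ω (weakDeriv Ω α f) ^ 2)
      (fun _ _ => zero_le) (Finset.HasAntidiagonal.mem_antidiagonal.2 rfl)
  have h2 := ENNReal.rpow_le_rpow h1 (by norm_num : (0 : ℝ) ≤ 1 / 2)
  rw [← ENNReal.rpow_natCast_mul] at h2
  norm_num at h2
  exact h2

theorem normL2_congr {Ω : Set Plane} {f g : Plane → ℝ} (h : f =ᵐ[volume.restrict Ω] g) :
    normL2 Ω f = normL2 Ω g := eLpNorm_congr_ae h

theorem MemSobolev.hasWeakDeriv {Ω : Set Plane} {m : ℕ} {q : ℝ≥0∞} {f : Plane → ℝ}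
    (hf : MemSobolev Ω m q f) {α : ℕ × ℕ} (hα : α.1 + α.2 ≤ m) :
    HasWeakDeriv Ω α f (weakDeriv Ω α f) :=
  (hf.2 α hα).choose_spec.1.weakDeriv

theorem MemSobolev.memLp_weakDeriv {Ω : Set Plane} (hΩ : IsOpen Ω) {m : ℕ} {q : ℝ≥0∞}
    {f : Plane → ℝ} (hf : MemSobolev Ω m q f) {α : ℕ × ℕ} (hα : α.1 + α.2 ≤ m) :
    MemLp (weakDeriv Ω α f) q (volume.restrict Ω) := by
  obtain ⟨g, h1, h2⟩ := hf.2 α hα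
  exact h2.ae_eq (h1.weakDeriv_ae_eq hΩ).symm

/-- Approximation of functions in the unit ball of `H¹₀` by test functions. -/
theorem exists_testFunction_approx {Ω : Set Plane} (hΩ : IsOpen Ω) {v : Plane → ℝ}
    (hv : MemH10 Ω v) (hv1 : normH Ω 1 v ≤ 1) {ε : ℝ≥0∞} (hε : 0 < ε) :
    ∃ φ, IsTestFunction Ω φ ∧ normL2 Ω (v - φ) ≤ ε ∧
      ∀ j, normL2 Ω (partialDeriv j φ) ≤ 1 + ε := by
  obtain ⟨φ, hφ, hn⟩ := hv.2 ε hε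
  refine ⟨φ, hφ, ?_, ?_⟩
  · have h0 : HasWeakDeriv Ω (0, 0) (v - φ) (v - φ) :=
      hasWeakDeriv_zero ((hv.1.hasWeakDeriv (α := (0, 0)) (by simp)).1.sub hφ.locallyIntegrableOn)
    rw [← normL2_congr (h0.weakDeriv_ae_eq hΩ)]
    exact (normL2_weakDeriv_le_normH (by simp) _).trans hn.le
  · have key : ∀ (α : ℕ × ℕ) (g : Plane → ℝ), α.1 + α.2 ≤ 1 → HasWeakDeriv Ω α φ g →
        AEStronglyMeasurable g (volume.restrict Ω) → normL2 Ω g ≤ 1 + ε := by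
      intro α g hα hg hgm
      have hw := hv.1.hasWeakDeriv hα
      have hwm := (hv.1.memLp_weakDeriv hΩ hα).aestronglyMeasurable
      have h1 := (hw.sub hg).weakDeriv_ae_eq hΩ
      have h2 : normL2 Ω (weakDeriv Ω α v - g) ≤ ε := by
        rw [← normL2_congr h1]
        exact (normL2_weakDeriv_le_normH hα _).trans hn.le
      have h3 : normL2 Ω (weakDeriv Ω α v) ≤ 1 := (normL2_weakDeriv_le_normH hα _).trans hv1
      calc normL2 Ω g = normL2 Ω (weakDeriv Ω α v - (weakDeriv Ω α v - g)) := by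
            congr 1; abel
        _ ≤ normL2 Ω (weakDeriv Ω α v) + normL2 Ω (weakDeriv Ω α v - g) :=
            eLpNorm_sub_le hwm (hwm.sub hgm) (by norm_num)
        _ ≤ 1 + ε := add_le_add h3 h2
    intro j
    fin_cases j
    · exact key (1, 0) _ (by simp) hφ.hasWeakDeriv_fst
        (hφ.partialDeriv 0).continuous.aestronglyMeasurable
    · exact key (0, 1) _ (by simp) hφ.hasWeakDeriv_snd
        (hφ.partialDeriv 1).continuous.aestronglyMeasurable

theorem normL2_le_one {Ω : Set Plane} (hΩ : IsOpen Ω) {v : Plane → ℝ} (hv : MemSobolev Ω 1 2 v)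
    (hv1 : normH Ω 1 v ≤ 1) : normL2 Ω v ≤ 1 := by
  have h0 : HasWeakDeriv Ω (0, 0) v v :=
    hasWeakDeriv_zero (hv.hasWeakDeriv (α := (0, 0)) (by simp)).1
  rw [← normL2_congr (h0.weakDeriv_ae_eq hΩ)]
  exact (normL2_weakDeriv_le_normH (by simp) _).trans hv1

theorem normWInftyModConst_lt_top {Ω : Set Plane} (hΩ : IsOpen Ω) {m : ℕ} {f : Plane → ℝ}
    (hf : MemSobolev Ω m ⊤ f) : normWInftyModConst Ω m f < ⊤ := by
  classical
  let S := (Finset.range (m + 1) ×ˢ Finset.range (m + 1)).filter fun α : ℕ × ℕ => α.1 + α.2 ≤ m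
  have h1 : normWInftyModConst Ω m f ≤
      ∑ α ∈ S, eLpNorm (weakDeriv Ω α f) ⊤ (volume.restrict Ω) := by
    refine iSup₂_le fun α hα => ?_
    refine Finset.single_le_sum (f := fun α => eLpNorm (weakDeriv Ω α f) ⊤ (volume.restrict Ω))
      (fun _ _ => zero_le) ?_
    simp only [S, Finset.mem_filter, Finset.mem_product, Finset.mem_range]
    omega
  refine h1.trans_lt (ENNReal.sum_lt_top.2 fun α hα => ?_)
  exact (hf.memLp_weakDeriv hΩ (Finset.mem_filter.1 hα).2).2

theorem eLpNorm_weakDeriv_le {Ω : Set Plane} {m : ℕ} (f : Plane → ℝ)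
    {α : ℕ × ℕ} (h1 : 1 ≤ α.1 + α.2) (hm : α.1 + α.2 ≤ m) :
    eLpNorm (weakDeriv Ω α f) ⊤ (volume.restrict Ω) ≤ normWInftyModConst Ω m f :=
  le_iSup₂ (f := fun (α : ℕ × ℕ) (_ : 1 ≤ α.1 + α.2 ∧ α.1 + α.2 ≤ m) =>
    eLpNorm (weakDeriv Ω α f) ⊤ (volume.restrict Ω)) α ⟨h1, hm⟩

/-! ### Mollification and pointwise Taylor estimates -/

/-- The convolution of `f` with the kernel `k`. -/
noncomputable def moll (f k : Plane → ℝ) : Plane → ℝ :=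
  convolution f k (ContinuousLinearMap.mul ℝ ℝ) volume

theorem moll_apply (f k : Plane → ℝ) (x : Plane) : moll f k x = ∫ t, f t * k (x - t) := rfl

theorem contDiff_moll {f k : Plane → ℝ} (hf : LocallyIntegrable f)
    (hk : IsTestFunction Set.univ k) : ContDiff ℝ ((⊤ : ℕ∞) : WithTop ℕ∞) (moll f k) :=
  hk.2.1.contDiff_convolution_right _ hf hk.1

theorem partialDeriv_moll {f k : Plane → ℝ} (hf : LocallyIntegrable f)
    (hk : IsTestFunction Set.univ k) (j : Fin 2) :
    partialDeriv j (moll f k) = moll f (partialDeriv j k) := by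
  funext x
  have h := (hk.2.1.hasFDerivAt_convolution_right (ContinuousLinearMap.mul ℝ ℝ) hf
    hk.contDiff_one x).fderiv
  unfold partialDeriv moll
  rw [h, convolution_precompR_apply _ hf (hk.2.1.fderiv ℝ)
    (hk.contDiff_one.continuous_fderiv one_ne_zero)]

theorem iterate_partialDeriv_moll {f k : Plane → ℝ} (hf : LocallyIntegrable f)
    (hk : IsTestFunction Set.univ k) (j : Fin 2) (n : ℕ) :
    (partialDeriv j)^[n] (moll f k) = moll f ((partialDeriv j)^[n] k) := by
  induction n with
  | zero => rfl
  | succ n ih =>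
    rw [Function.iterate_succ_apply', Function.iterate_succ_apply', ih,
      partialDeriv_moll hf (hk.iterate_partialDeriv j n)]

theorem multiDeriv_moll {f k : Plane → ℝ} (hf : LocallyIntegrable f)
    (hk : IsTestFunction Set.univ k) (α : ℕ × ℕ) :
    multiDeriv α (moll f k) = moll f (multiDeriv α k) := by
  unfold multiDeriv
  rw [iterate_partialDeriv_moll hf hk,
    iterate_partialDeriv_moll hf (hk.iterate_partialDeriv 1 α.2)]

theorem iterate_partialDeriv_reflect {k : Plane → ℝ} (hk : IsTestFunction Set.univ k)
    (j : Fin 2) (n : ℕ) (c : ℝ) (x : Plane) :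
    (partialDeriv j)^[n] (fun y => c * k (x - y)) =
      fun y => (-1) ^ n * c * (partialDeriv j)^[n] k (x - y) := by
  induction n with
  | zero => simp
  | succ n ih =>
    rw [Function.iterate_succ_apply', Function.iterate_succ_apply', ih]
    funext y
    have hd := (hk.iterate_partialDeriv j n).contDiff_one.differentiable one_ne_zero
    have h1 : HasFDerivAt (fun y => x - y) (-ContinuousLinearMap.id ℝ Plane) y :=
      (hasFDerivAt_id y).const_sub x
    have h2 := ((hd (x - y)).hasFDerivAt.comp y h1).const_mul ((-1) ^ n * c)
    have h3 := h2.fderiv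
    unfold partialDeriv at h3 ⊢
    simp only [Function.comp_def] at h3
    rw [h3]
    simp
    ring

theorem multiDeriv_reflect {k : Plane → ℝ} (hk : IsTestFunction Set.univ k) (α : ℕ × ℕ)
    (x y : Plane) :
    multiDeriv α (fun y => k (x - y)) y = (-1) ^ (α.1 + α.2) * multiDeriv α k (x - y) := by
  unfold multiDeriv
  have h1 := iterate_partialDeriv_reflect hk 1 α.2 1 x
  simp only [one_mul, mul_one] at h1
  rw [h1, iterate_partialDeriv_reflect (hk.iterate_partialDeriv 1 α.2)]
  ring

theorem ContDiffBump.isTestFunction (b : ContDiffBump (0 : Plane)) :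
    IsTestFunction Set.univ (b.normed volume) :=
  ⟨b.contDiff_normed, b.hasCompactSupport_normed, Set.subset_univ _⟩

/-- Since the ball lies in `Ω`, the translated and reflected kernel y ↦ k(x - y) is a test function
there. The sign from the reflection cancels the one in the definition of the weak derivative, so the
derivative of the mollification at `x` is an average of `g` against a nonnegative kernel of mass
one. -/
theorem abs_multiDeriv_moll_le {Ω : Set Plane} (hΩ : IsOpen Ω) {α : ℕ × ℕ} {f g : Plane → ℝ}
    (hf : IntegrableOn f Ω) (hg : HasWeakDeriv Ω α f g) {M : ℝ} (hM : 0 ≤ M)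
    (hgM : eLpNorm g ⊤ (volume.restrict Ω) ≤ ENNReal.ofReal M) (b : ContDiffBump (0 : Plane))
    {x : Plane} (hx : Metric.closedBall x b.rOut ⊆ Ω) :
    |multiDeriv α (moll (Ω.indicator f) (b.normed volume)) x| ≤ M := by
  have hk := ContDiffBump.isTestFunction b
  have hfi : LocallyIntegrable (Ω.indicator f) :=
    ((integrable_indicator_iff hΩ.measurableSet).2 hf).locallyIntegrable
  let φ : Plane → ℝ := fun y => b.normed volume (x - y)
  have hts : tsupport φ ⊆ Metric.closedBall x b.rOut := by
    refine closure_minimal (fun y hy => ?_) Metric.isClosed_closedBall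
    have : x - y ∈ Function.support (b.normed volume) := hy
    rw [b.support_normed_eq] at this
    rw [Metric.mem_closedBall, dist_comm, dist_eq_norm]
    simpa using (mem_ball_zero_iff.1 this).le
  have hφ : IsTestFunction Ω φ :=
    ⟨hk.1.comp (contDiff_const.sub contDiff_id),
      (isCompact_closedBall x b.rOut).of_isClosed_subset (isClosed_tsupport φ) hts, hts.trans hx⟩
  have e1 : multiDeriv α (moll (Ω.indicator f) (b.normed volume)) x = ∫ y in Ω, g y * φ y := by
    rw [multiDeriv_moll hfi hk, moll_apply]
    have h2 := hg.2.2 φ hφ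
    have h3 : ∀ y, multiDeriv α φ y =
        (-1) ^ (α.1 + α.2) * multiDeriv α (b.normed volume) (x - y) := multiDeriv_reflect hk α x
    simp only [h3, mul_left_comm (f _)] at h2
    rw [integral_const_mul] at h2
    rw [← mul_left_cancel₀ (pow_ne_zero _ (by norm_num)) h2, ← integral_indicator hΩ.measurableSet]
    refine integral_congr_ae (Filter.Eventually.of_forall fun y => ?_)
    by_cases hy : y ∈ Ω <;> simp [hy]
  have hφ0 : ∀ y, 0 ≤ φ y := fun y => b.nonneg_normed _
  have hφi : Integrable φ := hφ.continuous.integrable_of_hasCompactSupport hφ.2.1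
  have hφ1 : ∫ y, φ y = 1 := by
    rw [← b.integral_normed (μ := (volume : Measure Plane))]
    exact integral_sub_left_eq_self (fun y => b.normed volume y) volume x
  have hgb : ∀ᵐ y ∂volume.restrict Ω, ‖g y‖ ≤ M := by
    have := ae_le_eLpNormEssSup (f := g) (μ := volume.restrict Ω)
    filter_upwards [this] with y hy
    rw [eLpNorm_exponent_top] at hgM
    have h4 := hy.trans hgM
    rwa [← ofReal_norm, ENNReal.ofReal_le_ofReal_iff hM] at h4
  rw [e1, ← Real.norm_eq_abs]
  calc ‖∫ y in Ω, g y * φ y‖ ≤ ∫ y in Ω, M * φ y := by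
        refine norm_integral_le_of_norm_le (hφi.integrableOn.const_mul M) ?_
        filter_upwards [hgb] with y hy
        rw [norm_mul, Real.norm_of_nonneg (hφ0 y)]
        exact mul_le_mul_of_nonneg_right hy (hφ0 y)
    _ = M * ∫ y in Ω, φ y := integral_const_mul _ _
    _ ≤ M * ∫ y, φ y := by
        gcongr
        · exact Filter.Eventually.of_forall hφ0
        · exact Measure.restrict_le_self
    _ = M := by rw [hφ1, mul_one]

theorem norm_clm_le_of_basis {L : Plane →L[ℝ] ℝ} {c : ℝ}
    (h : ∀ j, |L (EuclideanSpace.single j 1)| ≤ c) : ‖L‖ ≤ 2 * c := by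
  have hc : 0 ≤ c := (abs_nonneg _).trans (h 0)
  refine L.opNorm_le_bound (by positivity) fun x => ?_
  have hx : x = x 0 • EuclideanSpace.single 0 (1 : ℝ) + x 1 • EuclideanSpace.single 1 (1 : ℝ) := by
    ext i; fin_cases i <;> simp
  have hn (i : Fin 2) : |x i| ≤ ‖x‖ := by
    simpa using PiLp.norm_apply_le x i
  calc ‖L x‖ = |x 0 * L (EuclideanSpace.single 0 1) + x 1 * L (EuclideanSpace.single 1 1)| := by
        conv_lhs => rw [hx, map_add, map_smul, map_smul]
        simp
    _ ≤ |x 0| * |L (EuclideanSpace.single 0 1)| + |x 1| * |L (EuclideanSpace.single 1 1)| := by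
        rw [← abs_mul, ← abs_mul]; exact abs_add_le _ _
    _ ≤ ‖x‖ * c + ‖x‖ * c := by gcongr <;> first | exact hn _ | exact h _
    _ = 2 * c * ‖x‖ := by ring

theorem partialDeriv_comm {F : Plane → ℝ} (hF : ContDiff ℝ ((⊤ : ℕ∞) : WithTop ℕ∞) F)
    (i j : Fin 2) (x : Plane) :
    partialDeriv i (partialDeriv j F) x = partialDeriv j (partialDeriv i F) x := by
  have hd : DifferentiableAt ℝ (fderiv ℝ F) x :=
    (hF.fderiv_right (m := ((⊤ : ℕ∞) : WithTop ℕ∞)) (by simp)).differentiable (by simp) x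
  have h (i j : Fin 2) : partialDeriv i (partialDeriv j F) x =
      fderiv ℝ (fderiv ℝ F) x (EuclideanSpace.single i 1) (EuclideanSpace.single j 1) := by
    unfold partialDeriv
    rw [fderiv_clm_apply hd (differentiableAt_const _)]
    simp
  rw [h, h]
  refine (hF.contDiffAt.isSymmSndFDerivAt ?_).eq _ _
  simp only [minSmoothness_of_isRCLikeNormedField]
  exact WithTop.coe_le_coe.2 (le_top : (2 : ℕ∞) ≤ ⊤)

/-- The mean value inequality is applied first to the partial derivatives and then to `F` minus its
linearisation. Each passage from partial derivatives to an operator norm costs a factor 2. -/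
theorem taylor_smooth {F : Plane → ℝ} (hF : ContDiff ℝ ((⊤ : ℕ∞) : WithTop ℕ∞) F) {P x : Plane}
    {M : ℝ} (h : ∀ y ∈ segment ℝ P x, ∀ i j, |partialDeriv i (partialDeriv j F) y| ≤ M) :
    |F x - F P - fderiv ℝ F P (x - P)| ≤ 4 * M * ‖x - P‖ ^ 2 := by
  have hM : 0 ≤ M := (abs_nonneg _).trans (h P (left_mem_segment ℝ P x) 0 0)
  have hdiff : Differentiable ℝ F := hF.differentiable (by simp)
  have h1 : ∀ y ∈ segment ℝ P x, ∀ j,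
      |partialDeriv j F y - partialDeriv j F P| ≤ 2 * M * ‖x - P‖ := by
    intro y hy j
    have h2 := (convex_segment P x).norm_image_sub_le_of_norm_fderiv_le (𝕜 := ℝ)
      (f := partialDeriv j F) (C := 2 * M)
      (fun z _ => (contDiff_partialDeriv hF j).differentiable (by simp) z)
      (fun z hz => norm_clm_le_of_basis fun i => h z hz i j) (left_mem_segment ℝ P x) hy
    refine h2.trans ?_
    gcongr
    obtain ⟨t, ht, rfl⟩ := (segment_eq_image' ℝ P x ▸ hy : _ ∈ (fun t : ℝ => P + t • (x - P)) '' _)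
    simp only [add_sub_cancel_left, norm_smul, Real.norm_eq_abs, abs_of_nonneg ht.1]
    exact mul_le_of_le_one_left (norm_nonneg _) ht.2
  have h3 := (convex_segment P x).norm_image_sub_le_of_norm_fderiv_le' (𝕜 := ℝ)
      (f := F) (φ := fderiv ℝ F P) (C := 2 * (2 * M * ‖x - P‖)) (fun z _ => hdiff z)
      (fun z hz => norm_clm_le_of_basis fun j => h1 z hz j) (left_mem_segment ℝ P x)
      (right_mem_segment ℝ P x)
  rw [Real.norm_eq_abs] at h3
  refine h3.trans (le_of_eq (by ring))

/-- A sequence of bump functions concentrating at the origin. -/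
noncomputable def bumpSeq (n : ℕ) : ContDiffBump (0 : Plane) :=
  ⟨1 / (2 * (n + 1)), 1 / (n + 1), by positivity, by
    rw [div_lt_div_iff₀ (by positivity) (by positivity)]
    have : (0 : ℝ) < n + 1 := by positivity
    linarith⟩

theorem tendsto_bumpSeq : Filter.Tendsto (fun n => (bumpSeq n).rOut) Filter.atTop (nhds 0) :=
  tendsto_one_div_add_atTop_nhds_zero_nat

theorem tendsto_moll_bumpSeq {Ω : Set Plane} (hΩ : IsOpen Ω) {f : Plane → ℝ}
    (hf : IntegrableOn f Ω) (hc : ContinuousOn f Ω) {x : Plane} (hx : x ∈ Ω) :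
    Filter.Tendsto (fun n => moll (Ω.indicator f) ((bumpSeq n).normed volume) x) Filter.atTop
      (nhds (f x)) := by
  have h1 : ContinuousAt (Ω.indicator f) x := by
    refine (hc.continuousAt (hΩ.mem_nhds hx)).congr ?_
    filter_upwards [hΩ.mem_nhds hx] with y hy
    simp [hy]
  have h2 := ContDiffBump.convolution_tendsto_right (μ := (volume : Measure Plane))
    (φ := bumpSeq) (g := fun _ => Ω.indicator f) (k := fun _ => x) (x₀ := x) (z₀ := f x)
    tendsto_bumpSeq
    (Filter.Eventually.of_forall fun _ =>
      ((integrable_indicator_iff hΩ.measurableSet).2 hf).aestronglyMeasurable) ?_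
    tendsto_const_nhds
  · refine h2.congr fun n => ?_
    rw [convolution_eq_swap, moll_apply]
    refine integral_congr_ae (Filter.Eventually.of_forall fun y => ?_)
    simp [mul_comm]
  · have h3 := h1.tendsto.comp (Filter.tendsto_snd (f := (Filter.atTop : Filter ℕ)) (g := nhds x))
    rw [Set.indicator_of_mem hx] at h3
    exact h3

theorem eventually_closedBall_subset {Ω : Set Plane} (hΩ : IsOpen Ω) {K : Set Plane}
    (hK : IsCompact K) (hKΩ : K ⊆ Ω) :
    ∀ᶠ n in Filter.atTop, ∀ y ∈ K, Metric.closedBall y (bumpSeq n).rOut ⊆ Ω := by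
  obtain ⟨δ, hδ, hsub⟩ := hK.exists_cthickening_subset_open hΩ hKΩ
  filter_upwards [tendsto_bumpSeq.eventually_le_const hδ] with n hn y hy
  exact (Metric.closedBall_subset_cthickening hy _).trans
    ((Metric.cthickening_mono hn _).trans hsub)

/-! ### Pointwise Lipschitz and Taylor bounds from bounded weak derivatives -/

section Taylor

variable {Ω : Set Plane} {f : Plane → ℝ} {M : ℝ}

/-- The weak derivatives of `f` of order `m` on `Ω` are bounded by `M`. -/
def WeakDerivBound (Ω : Set Plane) (m : ℕ) (f : Plane → ℝ) (M : ℝ) : Prop :=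
  ∀ α : ℕ × ℕ, α.1 + α.2 = m → ∃ g, HasWeakDeriv Ω α f g ∧
    eLpNorm g ⊤ (volume.restrict Ω) ≤ ENNReal.ofReal M

theorem WeakDerivBound.norm_fderiv_moll_le (hΩ : IsOpen Ω) (hf : IntegrableOn f Ω)
    (hM : 0 ≤ M) (h : WeakDerivBound Ω 1 f M) (b : ContDiffBump (0 : Plane))
    {x : Plane} (hx : Metric.closedBall x b.rOut ⊆ Ω) :
    ‖fderiv ℝ (moll (Ω.indicator f) (b.normed volume)) x‖ ≤ 2 * M := by
  refine norm_clm_le_of_basis fun j => ?_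
  fin_cases j
  · obtain ⟨g, hg, hgM⟩ := h (1, 0) rfl
    exact abs_multiDeriv_moll_le hΩ hf hg hM hgM b hx
  · obtain ⟨g, hg, hgM⟩ := h (0, 1) rfl
    exact abs_multiDeriv_moll_le hΩ hf hg hM hgM b hx

theorem WeakDerivBound.abs_partialDeriv_moll_le (hΩ : IsOpen Ω) (hf : IntegrableOn f Ω)
    (hM : 0 ≤ M) (h : WeakDerivBound Ω 2 f M) (b : ContDiffBump (0 : Plane))
    {x : Plane} (hx : Metric.closedBall x b.rOut ⊆ Ω) (i j : Fin 2) :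
    |partialDeriv i (partialDeriv j (moll (Ω.indicator f) (b.normed volume))) x| ≤ M := by
  have hfi : LocallyIntegrable (Ω.indicator f) :=
    ((integrable_indicator_iff hΩ.measurableSet).2 hf).locallyIntegrable
  have hs := contDiff_moll hfi (ContDiffBump.isTestFunction b)
  fin_cases i <;> fin_cases j
  · obtain ⟨g, hg, hgM⟩ := h (2, 0) rfl
    exact abs_multiDeriv_moll_le hΩ hf hg hM hgM b hx
  · obtain ⟨g, hg, hgM⟩ := h (1, 1) rfl
    exact abs_multiDeriv_moll_le hΩ hf hg hM hgM b hx
  · obtain ⟨g, hg, hgM⟩ := h (1, 1) rfl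
    have := abs_multiDeriv_moll_le hΩ hf hg hM hgM b hx
    -- `multiDeriv (1, 1)` applies ∂₁ before ∂₀; the opposite order needs the symmetry of second
    -- derivatives.
    have e := partialDeriv_comm hs 1 0 x
    exact (congrArg abs e).trans_le this
  · obtain ⟨g, hg, hgM⟩ := h (0, 2) rfl
    exact abs_multiDeriv_moll_le hΩ hf hg hM hgM b hx

/-- The bound holds for mollifications and passes to the limit by continuity of `f`. Compactness of
the segment keeps the mollification balls inside `Ω`, so no convexity of `Ω` is needed. -/
theorem WeakDerivBound.abs_sub_le (hΩ : IsOpen Ω) (hf : IntegrableOn f Ω)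
    (hc : ContinuousOn f Ω) (hM : 0 ≤ M) (h : WeakDerivBound Ω 1 f M) {P x : Plane}
    (hPx : segment ℝ P x ⊆ Ω) : |f x - f P| ≤ 2 * M * ‖x - P‖ := by
  have hfi : LocallyIntegrable (Ω.indicator f) :=
    ((integrable_indicator_iff hΩ.measurableSet).2 hf).locallyIntegrable
  have t1 := tendsto_moll_bumpSeq hΩ hf hc (hPx (right_mem_segment ℝ P x))
  have t2 := tendsto_moll_bumpSeq hΩ hf hc (hPx (left_mem_segment ℝ P x))
  refine le_of_tendsto (t1.sub t2).abs ?_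
  have hcomp : IsCompact (segment ℝ P x) := by
    rw [segment_eq_image_lineMap]
    exact isCompact_Icc.image (by fun_prop)
  filter_upwards [eventually_closedBall_subset hΩ hcomp hPx] with n hn
  have hs := contDiff_moll hfi (ContDiffBump.isTestFunction (bumpSeq n))
  exact (convex_segment P x).norm_image_sub_le_of_norm_fderiv_le (𝕜 := ℝ)
    (fun z _ => hs.differentiable (by simp) z)
    (fun z hz => h.norm_fderiv_moll_le hΩ hf hM (bumpSeq n) (hn z hz)) (left_mem_segment ℝ P x)
    (right_mem_segment ℝ P x)

/-- `L` is a subsequential limit of the gradients at `P` of the mollifications, which are bounded in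
a finite-dimensional space. The subsequence is chosen before `x`, so one `L` serves all segments
issuing from `P`. -/
theorem WeakDerivBound.exists_taylor (hΩ : IsOpen Ω) (hf : IntegrableOn f Ω)
    (hc : ContinuousOn f Ω) (hM : 0 ≤ M) (h₁ : WeakDerivBound Ω 1 f M)
    (h₂ : WeakDerivBound Ω 2 f M) {P : Plane} (hP : P ∈ Ω) :
    ∃ L : Plane →L[ℝ] ℝ, ‖L‖ ≤ 2 * M ∧ ∀ x, segment ℝ P x ⊆ Ω →
      |f x - f P - L (x - P)| ≤ 4 * M * ‖x - P‖ ^ 2 := by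
  have hfi : LocallyIntegrable (Ω.indicator f) :=
    ((integrable_indicator_iff hΩ.measurableSet).2 hf).locallyIntegrable
  let F : ℕ → Plane → ℝ := fun n => moll (Ω.indicator f) ((bumpSeq n).normed volume)
  have hball : ∀ᶠ n in Filter.atTop, fderiv ℝ (F n) P ∈ Metric.closedBall 0 (2 * M) := by
    filter_upwards [eventually_closedBall_subset hΩ isCompact_singleton
      (Set.singleton_subset_iff.2 hP)] with n hn
    rw [mem_closedBall_zero_iff]
    exact h₁.norm_fderiv_moll_le hΩ hf hM (bumpSeq n) (hn P rfl)
  have : ProperSpace (Plane →L[ℝ] ℝ) := FiniteDimensional.proper ℝ _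
  obtain ⟨L, hL, σ, hσ, hlim⟩ :=
    tendsto_subseq_of_frequently_bounded Metric.isBounded_closedBall hball.frequently
  rw [Metric.isClosed_closedBall.closure_eq, mem_closedBall_zero_iff] at hL
  refine ⟨L, hL, fun x hx => ?_⟩
  have t1 := (tendsto_moll_bumpSeq hΩ hf hc (hx (right_mem_segment ℝ P x))).comp hσ.tendsto_atTop
  have t2 := (tendsto_moll_bumpSeq hΩ hf hc hP).comp hσ.tendsto_atTop
  have t3 : Filter.Tendsto (fun n => fderiv ℝ (F (σ n)) P (x - P)) Filter.atTop
      (nhds (L (x - P))) :=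
    ((ContinuousLinearMap.apply ℝ ℝ (x - P)).continuous.tendsto L).comp hlim
  refine le_of_tendsto ((t1.sub t2).sub t3).abs ?_
  have hcomp : IsCompact (segment ℝ P x) := by
    rw [segment_eq_image_lineMap]
    exact isCompact_Icc.image (by fun_prop)
  filter_upwards [hσ.tendsto_atTop.eventually (eventually_closedBall_subset hΩ hcomp hx)] with n hn
  have hs := contDiff_moll hfi (ContDiffBump.isTestFunction (bumpSeq (σ n)))
  exact taylor_smooth hs fun y hy i j =>
    h₂.abs_partialDeriv_moll_le hΩ hf hM (bumpSeq (σ n)) (hn y hy) i j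

end Taylor

theorem MemSobolev.weakDerivBound {Ω : Set Plane} (hΩ : IsOpen Ω) {m q : ℕ} {f : Plane → ℝ}
    (hf : MemSobolev Ω m ⊤ f) (hq : 1 ≤ q) (hqm : q ≤ m) :
    WeakDerivBound Ω q f (normWInftyModConst Ω m f).toReal := by
  intro α hα
  refine ⟨weakDeriv Ω α f, hf.hasWeakDeriv (hα.trans_le hqm), ?_⟩
  rw [ENNReal.ofReal_toReal (normWInftyModConst_lt_top hΩ hf).ne]
  exact eLpNorm_weakDeriv_le f (hα.symm ▸ hq) (hα.trans_le hqm)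

/-! ### Nodal functions on a mesh -/

namespace IsMesh

variable {Ω : Set Plane} {T : Finset (Finset Plane)} {D : ℝ} {a : ℝ≥0∞}

theorem triangle_subset_closure (hT : IsMesh Ω T D a) {s : Finset Plane} (hs : s ∈ T) :
    triangle s ⊆ closure Ω := by
  rw [← hT.cover]
  exact Set.subset_biUnion_of_mem (u := fun s => triangle s) hs

theorem interior_triangle_subset (hT : IsMesh Ω T D a) (hΩ : interior (closure Ω) = Ω)
    {s : Finset Plane} (hs : s ∈ T) : interior (triangle s) ⊆ Ω := by
  rw [← hΩ]
  exact interior_mono (hT.triangle_subset_closure hs)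

theorem exists_mem_triangle (hT : IsMesh Ω T D a) {x : Plane} (hx : x ∈ closure Ω) :
    ∃ s ∈ T, x ∈ triangle s := by
  rw [← hT.cover] at hx
  simpa using hx

theorem nodalBasis_eq (hT : IsMesh Ω T D a) {s : Finset Plane} (hs : s ∈ T) {x : Plane}
    (hx : x ∈ triangle s) (P : Plane) : nodalBasis T P x = baryCoord s P x := by
  have h : ∃ s ∈ T, x ∈ triangle s := ⟨s, hs, hx⟩
  unfold nodalBasis
  rw [dif_pos h]
  exact hT.coherent _ h.choose_spec.1 s hs x h.choose_spec.2 hx P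

theorem nodalBasis_of_notMem_star (hT : IsMesh Ω T D a) {P x : Plane} (hx : x ∉ star T P) :
    nodalBasis T P x = 0 := by
  by_cases h : ∃ s ∈ T, x ∈ triangle s
  · obtain ⟨s, hs, hxs⟩ := h
    rw [hT.nodalBasis_eq hs hxs]
    refine baryCoord_of_notMem (fun hP => hx ?_) x
    simp only [star, Set.mem_iUnion]
    exact ⟨s, hs, hP, hxs⟩
  · unfold nodalBasis
    rw [dif_neg h]

theorem nodalBasis_mem_Icc (hT : IsMesh Ω T D a) (P x : Plane) :
    nodalBasis T P x ∈ Set.Icc (0 : ℝ) 1 := by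
  by_cases h : ∃ s ∈ T, x ∈ triangle s
  · obtain ⟨s, hs, hxs⟩ := h
    rw [hT.nodalBasis_eq hs hxs]
    exact ⟨(hT.isCell s hs).baryCoord_nonneg hxs P, (hT.isCell s hs).baryCoord_le_one hxs P⟩
  · unfold nodalBasis
    rw [dif_neg h]
    exact ⟨le_rfl, zero_le_one⟩

theorem continuousOn_nodalBasis (hT : IsMesh Ω T D a) (P : Plane) :
    ContinuousOn (nodalBasis T P) (closure Ω) := by
  have hU : ⋃ s ∈ T, triangle s = ⋃ s : {s // s ∈ T}, triangle s.1 := by ext; simp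
  rw [← hT.cover, hU]
  refine (locallyFinite_of_finite _).continuousOn_iUnion
    (fun s => (IsCell.isCompact_triangle s.1).isClosed) fun s => ?_
  exact ((hT.isCell s.1 s.2).continuous_baryCoord P).continuousOn.congr
    fun x hx => hT.nodalBasis_eq s.2 hx P

theorem nodalBasis_node [DecidableEq Plane] (hT : IsMesh Ω T D a) {s : Finset Plane} (hs : s ∈ T)
    {Q : Plane} (hQ : Q ∈ s) (P : Plane) : nodalBasis T P Q = if P = Q then 1 else 0 := by
  rw [hT.nodalBasis_eq hs (IsCell.subset_triangle s hQ), (hT.isCell s hs).baryCoord_vertex hQ]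

theorem mem_star {T : Finset (Finset Plane)} {P x : Plane} :
    x ∈ star T P ↔ ∃ s ∈ T, P ∈ s ∧ x ∈ triangle s := by
  simp only [star, Set.mem_iUnion, exists_prop]

/-- On a ray from `P` inside one triangle the nodal function decreases linearly from 1. If it were
larger at x' = 2P - x than at x, the ray through x' could be prolonged inside its triangle to a
point `y` whose reflection lies so far out that the nodal function would be negative there. But the
reflection of `y` is in the star, hence in a triangle with corner `P`, which by convexity also
contains x. -/
theorem nodalBasis_not_lt_reflect (hT : IsMesh Ω T D a) {P : Plane}
    (hP : ∀ x ∈ star T P, (2 : ℝ) • P - x ∈ star T P) {x : Plane} (hx : x ∈ star T P) :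
    ¬ nodalBasis T P x < nodalBasis T P ((2 : ℝ) • P - x) := by
  intro hlt
  obtain ⟨s, hs, hPs, hxs⟩ := mem_star.1 hx
  obtain ⟨t, ht, hPt, hxt⟩ := mem_star.1 (hP x hx)
  classical
  have hd1 := (hT.nodalBasis_mem_Icc P ((2 : ℝ) • P - x)).2
  have hc0 := (hT.nodalBasis_mem_Icc P x).1
  have hct := hT.isCell t ht
  set c := nodalBasis T P x with hc
  have hd : nodalBasis T P ((2 : ℝ) • P - x) = baryCoord t P ((2 : ℝ) • P - x) :=
    hT.nodalBasis_eq ht hxt P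
  set d := nodalBasis T P ((2 : ℝ) • P - x)
  -- The dilation factor must satisfy r(1 - d) ≤ 1 < r(1 - c). The reciprocal of the mean of 1 - c
  -- and 1 - d does so and remains defined when d = 1.
  set r := 2 / (2 - c - d) with hr
  have hpos : 0 < 2 - c - d := by linarith
  have hr0 : 0 < r := by positivity
  have hr1 : r * (1 - d) ≤ 1 := by
    rw [hr, div_mul_eq_mul_div, div_le_one hpos]; linarith
  have hr2 : 1 < r * (1 - c) := by
    rw [hr, div_mul_eq_mul_div, one_lt_div hpos]; linarith
  have hrone : 1 < r := by nlinarith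
  let y : Plane := P + r • (((2 : ℝ) • P - x) - P)
  have hy : y ∈ triangle t := by
    refine hct.mem_triangle.2 fun Q hQ => ?_
    rw [hct.baryCoord_lineMap, hct.baryCoord_vertex hPt]
    split_ifs with h
    · subst h
      rw [← hd]; linarith
    · have := hct.baryCoord_nonneg hxt Q
      nlinarith
  have hys := hP y (mem_star.2 ⟨t, ht, hPt, hy⟩)
  obtain ⟨q, hq, hPq, hyq⟩ := mem_star.1 hys
  have hcq := hT.isCell q hq
  have hxe : x = P + r⁻¹ • (((2 : ℝ) • P - y) - P) := by
    have : (2 : ℝ) • P - y - P = r • (x - P) := by simp only [y]; module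
    rw [this, smul_smul, inv_mul_cancel₀ hr0.ne']
    module
  have hrinv : r⁻¹ ≤ 1 := inv_le_one_of_one_le₀ hrone.le
  have hxq : x ∈ triangle q := by
    rw [hxe]
    have := (IsCell.convex_triangle q).add_smul_sub_mem (IsCell.subset_triangle q hPq) hyq
      ⟨(inv_pos.2 hr0).le, hrinv⟩
    exact this
  have h1 : c = 1 + r⁻¹ * (baryCoord q P ((2 : ℝ) • P - y) - 1) := by
    rw [hc, hT.nodalBasis_eq hq hxq]
    conv_lhs => rw [hxe]
    rw [hcq.baryCoord_lineMap, hcq.baryCoord_vertex hPq, if_pos rfl]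
  have h2 := hcq.baryCoord_nonneg hyq P
  have h3 : r * (1 - c) = 1 - baryCoord q P ((2 : ℝ) • P - y) := by
    rw [h1]
    field_simp
    ring
  linarith

theorem nodalBasis_reflect (hT : IsMesh Ω T D a) {P : Plane}
    (hP : (fun x : Plane => (2 : ℝ) • P - x) '' star T P = star T P) (x : Plane) :
    nodalBasis T P ((2 : ℝ) • P - x) = nodalBasis T P x := by
  have hinv (x : Plane) : (2 : ℝ) • P - ((2 : ℝ) • P - x) = x := by abel
  have h1 : ∀ x ∈ star T P, (2 : ℝ) • P - x ∈ star T P := fun x hx => by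
    rw [← hP]; exact Set.mem_image_of_mem _ hx
  by_cases hx : x ∈ star T P
  · refine le_antisymm (not_lt.1 (hT.nodalBasis_not_lt_reflect h1 hx)) (not_lt.1 ?_)
    have := hT.nodalBasis_not_lt_reflect h1 (h1 x hx)
    rwa [hinv] at this
  · rw [hT.nodalBasis_of_notMem_star hx, hT.nodalBasis_of_notMem_star]
    intro h
    exact hx (hinv x ▸ h1 _ h)

/-! ### Integration over a mesh -/

/-- A vertex `P` of `s` that is not one of `t` has coordinate zero on the intersection, which is
thus contained in a line. -/
theorem aedisjoint (hT : IsMesh Ω T D a) {s t : Finset Plane} (hs : s ∈ T) (ht : t ∈ T)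
    (hst : s ≠ t) : AEDisjoint volume (triangle s) (triangle t) := by
  have hne : ∃ P ∈ s, P ∉ t := by
    by_contra! h
    exact hst (Finset.eq_of_subset_of_card_le h
      (by rw [(hT.isCell s hs).card_eq, (hT.isCell t ht).card_eq]))
  obtain ⟨P, hPs, hPt⟩ := hne
  have hsub : triangle s ∩ triangle t ⊆ {x | baryCoord s P x = 0} := by
    rintro x ⟨hxs, hxt⟩
    exact (hT.coherent s hs t ht x hxs hxt P).trans (baryCoord_of_notMem hPt x)
  obtain ⟨A, hA⟩ := (hT.isCell s hs).exists_affine P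
  refine measure_mono_null hsub ?_
  classical
  have hset : {x | baryCoord s P x = 0} =
      ((AffineSubspace.comap A (AffineSubspace.mk' (0 : ℝ) ⊥) : AffineSubspace ℝ Plane) :
        Set Plane) := by
    ext x
    simp [hA]
  rw [hset]
  refine Measure.addHaar_affineSubspace _ _ fun htop => ?_
  have hP : P ∈ {x | baryCoord s P x = 0} := by
    rw [hset, htop]; trivial
  rw [Set.mem_ofPred_eq, (hT.isCell s hs).baryCoord_vertex hPs, if_pos rfl] at hP
  exact one_ne_zero hP

/-- Triangle interiors lie in `Ω` because there are no slits, so the boundary of `Ω` is covered by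
finitely many null frontiers of triangles. -/
theorem restrict_closure (hT : IsMesh Ω T D a) (hΩ : interior (closure Ω) = Ω) :
    (volume : Measure Plane).restrict (closure Ω) = volume.restrict Ω := by
  refine Measure.restrict_congr_set ?_
  refine (ae_eq_of_subset_of_measure_ge subset_closure ?_ (hΩ ▸ isOpen_interior).nullMeasurableSet
    ?_).symm
  · have hsub : closure Ω ⊆ Ω ∪ ⋃ s ∈ T, frontier (triangle s) := by
      intro x hx
      obtain ⟨s, hs, hxs⟩ := hT.exists_mem_triangle hx
      by_cases hxi : x ∈ interior (triangle s)
      · exact Or.inl (hT.interior_triangle_subset hΩ hs hxi)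
      · exact Or.inr (Set.mem_biUnion hs ⟨subset_closure hxs, hxi⟩)
    refine (measure_mono hsub).trans ((measure_union_le _ _).trans ?_)
    have h0 : volume (⋃ s ∈ T, frontier (triangle s)) = 0 :=
      (measure_biUnion_null_iff T.countable_toSet).2
        fun s _ => (IsCell.convex_triangle s).addHaar_frontier volume
    rw [h0, add_zero]
  · rw [← hT.cover]
    exact (T.finite_toSet.isCompact_biUnion
      fun s _ => IsCell.isCompact_triangle s).measure_lt_top.ne

theorem sum_lintegral (hT : IsMesh Ω T D a) (hΩ : interior (closure Ω) = Ω) (F : Plane → ℝ≥0∞) :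
    ∑ s ∈ T, ∫⁻ x in triangle s, F x = ∫⁻ x in Ω, F x := by
  rw [← hT.restrict_closure hΩ, ← hT.cover, lintegral_biUnion_finset₀]
  · exact fun s hs t ht hst => hT.aedisjoint hs ht hst
  · exact fun s _ => (IsCell.isCompact_triangle s).measurableSet.nullMeasurableSet

theorem sum_volume (hT : IsMesh Ω T D a) {S : Finset (Finset Plane)} (hS : S ⊆ T) :
    ∑ s ∈ S, volume (triangle s) = volume (⋃ s ∈ S, triangle s) := by
  rw [measure_biUnion_finset₀]
  · exact fun s hs t ht hst => hT.aedisjoint (hS hs) (hS ht) hst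
  · exact fun s _ => (IsCell.isCompact_triangle s).measurableSet.nullMeasurableSet

end IsMesh

/-! ### Vertex values against the L² norm -/

/-- An inverse estimate independent of the shape of the triangle. Let |u| have its largest vertex
value m at P. On the copy of the triangle shrunk by 1/4 towards P, u differs from u(P) by at most
(1/4)·2m, so |u| ≥ m/2 there. The copy has 1/16 of the area, and 4·16 = 64. -/
theorem IsCell.exists_vertex_bound {s : Finset Plane} (hs : IsCell s) {u : Plane → ℝ}
    (hu : ∃ A : Plane →ᵃ[ℝ] ℝ, Set.EqOn u A (triangle s)) :
    ∃ m : ℝ, 0 ≤ m ∧ (∀ P ∈ s, |u P| ≤ m) ∧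
      ENNReal.ofReal (m ^ 2) * volume (triangle s) ≤ 64 * ∫⁻ x in triangle s, ‖u x‖ₑ ^ 2 := by
  obtain ⟨A, hA⟩ := hu
  have hne : s.Nonempty := by rw [← Finset.card_pos, hs.card_eq]; norm_num
  obtain ⟨P, hP, hmax⟩ := s.exists_max_image (fun P => |u P|) hne
  refine ⟨|u P|, abs_nonneg _, hmax, ?_⟩
  have hPs := IsCell.subset_triangle s hP
  have hle : ∀ x ∈ triangle s, |A x| ≤ |u P| := by
    intro x hx
    rw [hs.affine_apply A x]
    calc |∑ Q ∈ s, baryCoord s Q x * A Q| ≤ ∑ Q ∈ s, |baryCoord s Q x * A Q| :=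
          Finset.abs_sum_le_sum_abs _ _
      _ ≤ ∑ Q ∈ s, baryCoord s Q x * |u P| := by
          refine Finset.sum_le_sum fun Q hQ => ?_
          rw [abs_mul, abs_of_nonneg (hs.baryCoord_nonneg hx Q),
            ← hA (IsCell.subset_triangle s hQ)]
          exact mul_le_mul_of_nonneg_left (hmax Q hQ) (hs.baryCoord_nonneg hx Q)
      _ = |u P| := by rw [← Finset.sum_mul, hs.sum_baryCoord, one_mul]
  let S : Set Plane := AffineMap.homothety P (1 / 4 : ℝ) '' triangle s
  have hSsub : S ⊆ triangle s := by
    rintro _ ⟨x, hx, rfl⟩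
    rw [AffineMap.homothety_apply, vsub_eq_sub, vadd_eq_add, add_comm]
    exact (IsCell.convex_triangle s).add_smul_sub_mem hPs hx (by norm_num)
  have hSvol : volume S = ENNReal.ofReal (1 / 16) * volume (triangle s) := by
    rw [Measure.addHaar_image_homothety]
    norm_num
  have hSlow : ∀ y ∈ S, ENNReal.ofReal ((|u P| / 2) ^ 2) ≤ ‖u y‖ₑ ^ 2 := by
    intro y hy
    rw [hA (hSsub hy)]
    obtain ⟨x, hx, rfl⟩ := hy
    have hxm := hle x hx
    have e : A (AffineMap.homothety P (1 / 4 : ℝ) x) = A P + (1 / 4) * (A x - A P) := by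
      rw [AffineMap.homothety_eq_lineMap, AffineMap.apply_lineMap, AffineMap.lineMap_apply]
      simp; ring
    rw [← ofReal_norm, ← ENNReal.ofReal_pow (norm_nonneg _), Real.norm_eq_abs, e]
    refine ENNReal.ofReal_le_ofReal (pow_le_pow_left₀ (by positivity) ?_ 2)
    have hAP : u P = A P := hA hPs
    rw [hAP] at hxm ⊢
    have h1 : A P = (A P + 1 / 4 * (A x - A P)) - (1 / 4) * (A x - A P) := by ring
    have h2 : |A P| ≤ |A P + 1 / 4 * (A x - A P)| + (1 / 4) * (|A x| + |A P|) := by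
      conv_lhs => rw [h1]
      refine (abs_sub _ _).trans ?_
      rw [abs_mul (1 / 4 : ℝ), abs_of_nonneg (by norm_num : (0 : ℝ) ≤ 1 / 4)]
      gcongr
      exact abs_sub _ _
    linarith
  have hSm : MeasurableSet S := by
    refine ((IsCell.isCompact_triangle s).image ?_).measurableSet
    exact AffineMap.continuous_of_finiteDimensional _
  calc ENNReal.ofReal (|u P| ^ 2) * volume (triangle s)
      = 64 * (ENNReal.ofReal ((|u P| / 2) ^ 2) * volume S) := by
        rw [hSvol, ← mul_assoc, ← mul_assoc,
          show (64 : ℝ≥0∞) = ENNReal.ofReal 64 by norm_num,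
          ← ENNReal.ofReal_mul (by norm_num), ← ENNReal.ofReal_mul (by positivity)]
        congr 2; ring
    _ = 64 * ∫⁻ _ in S, ENNReal.ofReal ((|u P| / 2) ^ 2) := by rw [setLIntegral_const]
    _ ≤ 64 * ∫⁻ x in S, ‖u x‖ₑ ^ 2 := by
        exact mul_le_mul' le_rfl (setLIntegral_mono' hSm hSlow)
    _ ≤ _ := by
        gcongr

theorem sq_sum_mul_le {ι : Type*} (s : Finset ι) (f g : ι → ℝ≥0∞) :
    (∑ i ∈ s, f i * g i) ^ 2 ≤ (∑ i ∈ s, f i ^ 2) * ∑ i ∈ s, g i ^ 2 := by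
  have h := ENNReal.inner_le_Lp_mul_Lq s f g Real.HolderConjugate.two_two
  calc (∑ i ∈ s, f i * g i) ^ 2
      ≤ ((∑ i ∈ s, f i ^ (2 : ℝ)) ^ (1 / 2 : ℝ) * (∑ i ∈ s, g i ^ (2 : ℝ)) ^ (1 / 2 : ℝ)) ^ 2 := by
        gcongr
    _ = _ := by
        rw [mul_pow, ← ENNReal.rpow_mul_natCast, ← ENNReal.rpow_mul_natCast]
        norm_num

theorem rpow_half_sq (x : ℝ≥0∞) : (x ^ (1 / 2 : ℝ)) ^ 2 = x := by
  rw [← ENNReal.rpow_mul_natCast]; norm_num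

theorem le_rpow_half {x y : ℝ≥0∞} (h : x ^ 2 ≤ y) : x ≤ y ^ (1 / 2 : ℝ) := by
  rw [← rpow_half_sq y] at h
  exact (ENNReal.pow_le_pow_left_iff two_ne_zero).1 h

/-- A weighted Cauchy–Schwarz inequality: if `J i ^ 2 ≤ w i * G i`, then
`(∑ c i * J i) ^ 2 ≤ (∑ c i ^ 2 * w i) * ∑ G i`. -/
theorem sq_sum_mul_le_of_sq_le {ι : Type*} (s : Finset ι) (c J w G : ι → ℝ≥0∞)
    (h : ∀ i ∈ s, J i ^ 2 ≤ w i * G i) :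
    (∑ i ∈ s, c i * J i) ^ 2 ≤ (∑ i ∈ s, c i ^ 2 * w i) * ∑ i ∈ s, G i := by
  calc (∑ i ∈ s, c i * J i) ^ 2
      ≤ (∑ i ∈ s, (c i * w i ^ (1 / 2 : ℝ)) * G i ^ (1 / 2 : ℝ)) ^ 2 := by
        refine pow_le_pow_left' (Finset.sum_le_sum fun i hi => ?_) 2
        rw [mul_assoc, ← ENNReal.mul_rpow_of_nonneg _ _ (by norm_num)]
        exact mul_le_mul' le_rfl (le_rpow_half (h i hi))
    _ ≤ _ := by
        refine (sq_sum_mul_le s _ _).trans (le_of_eq ?_)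
        simp only [mul_pow, rpow_half_sq]

theorem sq_enorm_eq_ofReal (x : ℝ) : ‖x‖ₑ ^ 2 = ENNReal.ofReal (x ^ 2) := by
  rw [← ofReal_norm, ← ENNReal.ofReal_pow (norm_nonneg _), Real.norm_eq_abs, sq_abs]

namespace IsMesh

variable {Ω : Set Plane} {T : Finset (Finset Plane)} {D : ℝ} {a : ℝ≥0∞}

/-- The pointwise bound is demanded only in the interiors of triangles: from there, segments to
vertices in Ω stay in Ω, while an edge may lie on the boundary. -/
theorem lintegral_sq_le (hT : IsMesh Ω T D a) (hΩ : interior (closure Ω) = Ω) {u w : Plane → ℝ}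
    (hu : ∀ s ∈ T, ∃ A : Plane →ᵃ[ℝ] ℝ, Set.EqOn u A (triangle s)) {R : ℝ}
    (hw : ∀ s ∈ T, ∀ x ∈ interior (triangle s), ∀ m, 0 ≤ m → (∀ P ∈ s, |u P| ≤ m) →
      |w x| ≤ R * m) :
    ∫⁻ x in Ω, ‖w x‖ₑ ^ 2 ≤ ENNReal.ofReal (64 * R ^ 2) * ∫⁻ x in Ω, ‖u x‖ₑ ^ 2 := by
  rw [← hT.sum_lintegral hΩ, ← hT.sum_lintegral hΩ, Finset.mul_sum]
  refine Finset.sum_le_sum fun s hs => ?_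
  obtain ⟨m, hm, hmP, hms⟩ := (hT.isCell s hs).exists_vertex_bound (hu s hs)
  have hae : (interior (triangle s) : Set Plane) =ᵐ[volume] triangle s :=
    interior_ae_eq_of_null_frontier ((IsCell.convex_triangle s).addHaar_frontier volume)
  rw [← setLIntegral_congr hae]
  calc ∫⁻ x in interior (triangle s), ‖w x‖ₑ ^ 2
      ≤ ∫⁻ _ in interior (triangle s), ENNReal.ofReal (R ^ 2) * ENNReal.ofReal (m ^ 2) := by
        refine setLIntegral_mono' isOpen_interior.measurableSet fun x hx => ?_
        rw [sq_enorm_eq_ofReal, ← ENNReal.ofReal_mul (by positivity), ← mul_pow, ← sq_abs]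
        exact ENNReal.ofReal_le_ofReal
          (pow_le_pow_left₀ (abs_nonneg _) (hw s hs x hx m hm hmP) 2)
    _ = ENNReal.ofReal (R ^ 2) * (ENNReal.ofReal (m ^ 2) * volume (triangle s)) := by
        rw [setLIntegral_const, IsCell.volume_interior, mul_assoc]
    _ ≤ ENNReal.ofReal (R ^ 2) * (64 * ∫⁻ x in triangle s, ‖u x‖ₑ ^ 2) :=
        mul_le_mul' le_rfl hms
    _ = _ := by
        rw [mul_comm 64 (R ^ 2), ENNReal.ofReal_mul (by positivity), ENNReal.ofReal_ofNat, mul_assoc]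

/-- After exchanging the sums each triangle is counted once per vertex, which gives 3·64 = 192. -/
theorem sum_sq_mul_volume_star_le (hT : IsMesh Ω T D a) (hΩ : interior (closure Ω) = Ω)
    {u : Plane → ℝ} (hu : ∀ s ∈ T, ∃ A : Plane →ᵃ[ℝ] ℝ, Set.EqOn u A (triangle s))
    (N : Finset Plane) :
    ∑ P ∈ N, ‖u P‖ₑ ^ 2 * volume (star T P) ≤ 192 * ∫⁻ x in Ω, ‖u x‖ₑ ^ 2 := by
  classical
  have hstar (P : Plane) : volume (star T P) ≤ ∑ s ∈ T, if P ∈ s then volume (triangle s) else 0 := by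
    refine (measure_biUnion_finset_le T _).trans (Finset.sum_le_sum fun s _ => ?_)
    split_ifs with h <;> simp [h]
  calc ∑ P ∈ N, ‖u P‖ₑ ^ 2 * volume (star T P)
      ≤ ∑ P ∈ N, ∑ s ∈ T, if P ∈ s then ‖u P‖ₑ ^ 2 * volume (triangle s) else 0 := by
        refine Finset.sum_le_sum fun P _ => (mul_le_mul' le_rfl (hstar P)).trans (le_of_eq ?_)
        rw [Finset.mul_sum]
        simp only [mul_ite, mul_zero]
    _ = ∑ s ∈ T, ∑ P ∈ N, if P ∈ s then ‖u P‖ₑ ^ 2 * volume (triangle s) else 0 :=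
        Finset.sum_comm
    _ ≤ ∑ s ∈ T, 192 * ∫⁻ x in triangle s, ‖u x‖ₑ ^ 2 := by
        refine Finset.sum_le_sum fun s hs => ?_
        obtain ⟨m, hm, hmP, hms⟩ := (hT.isCell s hs).exists_vertex_bound (hu s hs)
        rw [← Finset.sum_filter]
        calc ∑ P ∈ N.filter (· ∈ s), ‖u P‖ₑ ^ 2 * volume (triangle s)
            ≤ ∑ P ∈ s, ‖u P‖ₑ ^ 2 * volume (triangle s) :=
              Finset.sum_le_sum_of_subset fun P hP => (Finset.mem_filter.1 hP).2
          _ ≤ ∑ P ∈ s, 64 * ∫⁻ x in triangle s, ‖u x‖ₑ ^ 2 := by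
              refine Finset.sum_le_sum fun P hP => le_trans (mul_le_mul' ?_ le_rfl) hms
              rw [sq_enorm_eq_ofReal, ← sq_abs]
              exact ENNReal.ofReal_le_ofReal (pow_le_pow_left₀ (abs_nonneg _) (hmP P hP) 2)
          _ = 192 * ∫⁻ x in triangle s, ‖u x‖ₑ ^ 2 := by
              rw [Finset.sum_const, (hT.isCell s hs).card_eq, nsmul_eq_mul, ← mul_assoc]
              norm_num
    _ = _ := by rw [← Finset.mul_sum, hT.sum_lintegral hΩ]

/-! ### Bounded overlap of the squares around the nodes -/

theorem measurableSet_square (P : Plane) (h : ℝ) : MeasurableSet (square P h) := by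
  have : IsClosed (square P h) := by
    simp only [square, Set.ofPred_forall]
    exact isClosed_iInter fun i => isClosed_le (by fun_prop) continuous_const
  exact this.measurableSet

theorem dist_le_of_mem_square {P x : Plane} {h : ℝ} (hx : x ∈ square P h) :
    dist x P ≤ 2 * h := by
  have h0 := hx 0
  have h1 := hx 1
  have hh : 0 ≤ h := (abs_nonneg _).trans h0
  rw [EuclideanSpace.dist_eq, Fin.sum_univ_two, Real.dist_eq, Real.dist_eq]
  refine Real.sqrt_le_iff.2 ⟨by positivity, ?_⟩
  nlinarith [abs_nonneg (x 0 - P 0), abs_nonneg (x 1 - P 1)]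

-- A packing argument. Each counted node is a corner of a triangle of area at least `a` inside the
-- ball of radius 3D: the node is within 2D of `x`, and the triangle adds D. The triangles are
-- essentially disjoint and each has only three corners.
open Classical in
theorem card_square_mul_le (hT : IsMesh Ω T D a) {N : Finset Plane}
    (hN : ∀ P ∈ N, ∃ s ∈ T, P ∈ s) (x : Plane) :
    ((N.filter fun P => x ∈ square P D).card : ℝ≥0∞) * a ≤
      3 * volume (Metric.closedBall x (3 * D)) := by
  let N' := N.filter fun P => x ∈ square P D
  let S := T.filter fun s => ∃ P ∈ N', P ∈ s
  have hsub : ⋃ s ∈ S, triangle s ⊆ Metric.closedBall x (3 * D) := by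
    refine Set.iUnion₂_subset fun s hs y hy => ?_
    obtain ⟨hsT, P, hP, hPs⟩ := Finset.mem_filter.1 hs
    have h1 := dist_le_of_mem_square (Finset.mem_filter.1 hP).2
    have h2 := IsCell.dist_le s (hT.dist_le s hsT) hy (IsCell.subset_triangle s hPs)
    rw [Metric.mem_closedBall]
    have := dist_triangle_right y x P
    linarith
  calc (N'.card : ℝ≥0∞) * a = ∑ P ∈ N', a := by rw [Finset.sum_const, nsmul_eq_mul]
    _ ≤ ∑ P ∈ N', ∑ s ∈ S, if P ∈ s then volume (triangle s) else 0 := by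
        refine Finset.sum_le_sum fun P hP => ?_
        obtain ⟨s, hs, hPs⟩ := hN P (Finset.mem_filter.1 hP).1
        refine (hT.le_volume s hs).trans ?_
        have := Finset.single_le_sum (f := fun s => if P ∈ s then volume (triangle s) else 0)
          (fun _ _ => zero_le) (Finset.mem_filter.2 ⟨hs, P, hP, hPs⟩ : s ∈ S)
        simpa [hPs] using this
    _ = ∑ s ∈ S, ∑ P ∈ N', if P ∈ s then volume (triangle s) else 0 := Finset.sum_comm
    _ ≤ ∑ s ∈ S, 3 * volume (triangle s) := by
        refine Finset.sum_le_sum fun s hs => ?_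
        rw [← Finset.sum_filter]
        calc ∑ P ∈ N'.filter (· ∈ s), volume (triangle s)
            ≤ ∑ P ∈ s, volume (triangle s) :=
              Finset.sum_le_sum_of_subset fun P hP => (Finset.mem_filter.1 hP).2
          _ = _ := by
              rw [Finset.sum_const, (hT.isCell s (Finset.mem_filter.1 hs).1).card_eq, nsmul_eq_mul]
              norm_num
    _ = 3 * volume (⋃ s ∈ S, triangle s) := by
        rw [← Finset.mul_sum, hT.sum_volume (Finset.filter_subset _ _)]
    _ ≤ _ := mul_le_mul' le_rfl (measure_mono hsub)

theorem mul_sum_lintegral_square_le (hT : IsMesh Ω T D a) (hD : 0 ≤ D) {N : Finset Plane}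
    (hN : ∀ P ∈ N, ∃ s ∈ T, P ∈ s) {G : Plane → ℝ≥0∞} (hG : Measurable G) :
    a * ∑ P ∈ N, ∫⁻ x in square P D, G x ≤
      ENNReal.ofReal (27 * D ^ 2) * volume (Metric.ball (0 : Plane) 1) * ∫⁻ x, G x := by
  classical
  have hvol (x : Plane) : 3 * volume (Metric.closedBall x (3 * D)) =
      ENNReal.ofReal (27 * D ^ 2) * volume (Metric.ball (0 : Plane) 1) := by
    rw [Measure.addHaar_closedBall _ _ (by positivity), ← mul_assoc,
      show (3 : ℝ≥0∞) = ENNReal.ofReal 3 by norm_num, ← ENNReal.ofReal_mul (by norm_num)]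
    congr 2
    simp; ring
  calc a * ∑ P ∈ N, ∫⁻ x in square P D, G x
      = ∫⁻ x, a * ∑ P ∈ N, (square P D).indicator G x := by
        rw [lintegral_const_mul, lintegral_finsetSum]
        · congr 1
          exact Finset.sum_congr rfl fun P _ => (lintegral_indicator (measurableSet_square P D) G).symm
        · exact fun P _ => hG.indicator (measurableSet_square P D)
        · exact Finset.measurable_sum _ fun P _ => hG.indicator (measurableSet_square P D)
    _ ≤ ∫⁻ x, ENNReal.ofReal (27 * D ^ 2) * volume (Metric.ball (0 : Plane) 1) * G x := by
        refine lintegral_mono fun x => ?_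
        rw [← hvol x]
        refine le_trans (le_of_eq ?_) (mul_le_mul' (hT.card_square_mul_le hN x) le_rfl)
        simp only [Set.indicator_apply]
        rw [← Finset.sum_filter, Finset.sum_const, nsmul_eq_mul]
        ring
    _ = _ := lintegral_const_mul _ hG

/-! ### Stars and first moments of the nodal functions -/

theorem star_subset_closure (hT : IsMesh Ω T D a) (P : Plane) : star T P ⊆ closure Ω := by
  intro x hx
  obtain ⟨s, hs, -, hxs⟩ := mem_star.1 hx
  exact hT.triangle_subset_closure hs hxs

theorem norm_sub_le_of_mem_star (hT : IsMesh Ω T D a) {P x : Plane} (hx : x ∈ star T P) :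
    ‖x - P‖ ≤ D := by
  obtain ⟨s, hs, hP, hxs⟩ := mem_star.1 hx
  rw [← dist_eq_norm]
  exact IsCell.dist_le s (hT.dist_le s hs) hxs (IsCell.subset_triangle s hP)

theorem star_subset_square (hT : IsMesh Ω T D a) (P : Plane) : star T P ⊆ square P D := by
  intro x hx i
  refine le_trans ?_ (hT.norm_sub_le_of_mem_star hx)
  simpa using PiLp.norm_apply_le (x - P) i

theorem isCompact_star (T : Finset (Finset Plane)) (P : Plane) : IsCompact (star T P) := by
  refine T.finite_toSet.isCompact_biUnion fun s _ => ?_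
  by_cases h : P ∈ s
  · simpa [h] using IsCell.isCompact_triangle s
  · simp [h]

theorem isCompact_closure (hT : IsMesh Ω T D a) : IsCompact (closure Ω) := by
  rw [← hT.cover]
  exact T.finite_toSet.isCompact_biUnion fun s _ => IsCell.isCompact_triangle s

theorem integrable_nodalBasis_mul (hT : IsMesh Ω T D a) (P : Plane) {g : Plane → ℝ}
    (hg : Continuous g) : Integrable fun x => nodalBasis T P x * g x := by
  have h1 : IntegrableOn (fun x => nodalBasis T P x * g x) (closure Ω) :=
    ((hT.continuousOn_nodalBasis P).mul hg.continuousOn).integrableOn_compact hT.isCompact_closure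
  refine (integrableOn_iff_integrable_of_support_subset fun x hx => ?_).1 h1
  by_contra h
  exact hx (by
    simp only [hT.nodalBasis_of_notMem_star fun hs => h (hT.star_subset_closure P hs), zero_mul])

/-- The heart of the second-order bound. An even nodal function times an odd linear form annihilates
the even part of `v` about `P`, so `v` may be replaced by half of v(x) - v(2P - x). The factor |L(x
- P)|/2 is at most MD on the star; Cauchy–Schwarz on the star and the reflection estimate on the
surrounding square supply the rest. -/
theorem enorm_integral_moment_sq_le (hT : IsMesh Ω T D a) {P : Plane}
    (hP : (fun x : Plane => (2 : ℝ) • P - x) '' star T P = star T P) {v : Plane → ℝ}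
    (hv : ContDiff ℝ 1 v) {L : Plane →L[ℝ] ℝ} {M : ℝ} (hL : ‖L‖ ≤ 2 * M)
    (hM : 0 ≤ M) (hD : 0 ≤ D) :
    ‖∫ x, nodalBasis T P x * (L (x - P) * v x)‖ₑ ^ 2 ≤ volume (star T P) *
      (ENNReal.ofReal (8 * M ^ 2 * D ^ 4) * ∫⁻ x in square P D,
        (‖partialDeriv 0 v x‖ₑ ^ 2 + ‖partialDeriv 1 v x‖ₑ ^ 2)) := by
  have hvc := hv.continuous
  let F : Plane → ℝ := fun x => nodalBasis T P x * (L (x - P) * v x)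
  have hF : Integrable F := hT.integrable_nodalBasis_mul P (by fun_prop)
  have hrefl : ∫ x, F x = ∫ x, F ((2 : ℝ) • P - x) :=
    (integral_sub_left_eq_self F volume ((2 : ℝ) • P)).symm
  have hFr : ∀ x, F ((2 : ℝ) • P - x) =
      -(nodalBasis T P x * (L (x - P) * v ((2 : ℝ) • P - x))) := by
    intro x
    have e : (2 : ℝ) • P - x - P = -(x - P) := by module
    simp only [F]
    rw [hT.nodalBasis_reflect hP, e, map_neg]
    ring
  have hF2 : Integrable fun x => F ((2 : ℝ) • P - x) := hF.comp_sub_left _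
  have h2 : ∫ x, F x =
      ∫ x, nodalBasis T P x * ((1 / 2) * L (x - P) * (v x - v ((2 : ℝ) • P - x))) := by
    have h3 : ∫ x, F x = (1 / 2) * ∫ x, (F x + F ((2 : ℝ) • P - x)) := by
      rw [integral_add hF hF2, ← hrefl]; ring
    rw [h3, ← integral_const_mul]
    refine integral_congr_ae (Filter.Eventually.of_forall fun x => ?_)
    simp only [hFr]
    simp only [F]
    ring
  have hpt : ∀ x, ‖nodalBasis T P x * ((1 / 2) * L (x - P) * (v x - v ((2 : ℝ) • P - x)))‖ₑ ≤
      (star T P).indicator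
        (fun x => ENNReal.ofReal (M * D) * ‖v x - v ((2 : ℝ) • P - x)‖ₑ) x := by
    intro x
    by_cases hx : x ∈ star T P
    · rw [Set.indicator_of_mem hx, ← ofReal_norm, ← ofReal_norm, ← ENNReal.ofReal_mul (by positivity)]
      refine ENNReal.ofReal_le_ofReal ?_
      have hn := hT.nodalBasis_mem_Icc P x
      have hLx : ‖L (x - P)‖ ≤ 2 * M * D :=
        (L.le_opNorm _).trans (mul_le_mul hL (hT.norm_sub_le_of_mem_star hx) (norm_nonneg _)
          (by positivity))
      rw [norm_mul, norm_mul, norm_mul, Real.norm_of_nonneg hn.1,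
        Real.norm_of_nonneg (by norm_num : (0 : ℝ) ≤ 1 / 2)]
      calc nodalBasis T P x * (1 / 2 * ‖L (x - P)‖ * ‖v x - v ((2 : ℝ) • P - x)‖)
          ≤ 1 * (1 / 2 * (2 * M * D) * ‖v x - v ((2 : ℝ) • P - x)‖) := by
            gcongr
            exact hn.2
        _ = _ := by ring
    · rw [hT.nodalBasis_of_notMem_star hx]; simp
  have hms : MeasurableSet (star T P) := (isCompact_star T P).measurableSet
  have hmeas : Measurable fun x => ‖v x - v ((2 : ℝ) • P - x)‖ₑ :=
    (by fun_prop : Continuous fun x => v x - v ((2 : ℝ) • P - x)).measurable.enorm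
  have h4 : ‖∫ x, F x‖ₑ ≤ ENNReal.ofReal (M * D) *
      ∫⁻ x in star T P, 1 * ‖v x - v ((2 : ℝ) • P - x)‖ₑ := by
    rw [h2]
    refine (enorm_integral_le_lintegral_enorm _).trans ((lintegral_mono hpt).trans (le_of_eq ?_))
    rw [lintegral_indicator hms, lintegral_const_mul _ hmeas]
    simp only [one_mul]
  calc ‖∫ x, F x‖ₑ ^ 2
      ≤ ENNReal.ofReal (M * D) ^ 2 *
          (∫⁻ x in star T P, 1 * ‖v x - v ((2 : ℝ) • P - x)‖ₑ) ^ 2 := by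
        rw [← mul_pow]; exact pow_le_pow_left' h4 2
    _ ≤ ENNReal.ofReal (M * D) ^ 2 * (volume (star T P) *
          (ENNReal.ofReal (8 * D ^ 2) * ∫⁻ x in square P D,
            (‖partialDeriv 0 v x‖ₑ ^ 2 + ‖partialDeriv 1 v x‖ₑ ^ 2))) := by
        refine mul_le_mul' le_rfl ((sq_lintegral_mul_le aemeasurable_const
          hmeas.aemeasurable).trans (mul_le_mul' (by simp) ?_))
        exact (lintegral_mono_set (hT.star_subset_square P)).trans
          (lintegral_sub_reflect_sq_le hv P hD)
    _ = _ := by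
        rw [← ENNReal.ofReal_pow (by positivity),
          show 8 * M ^ 2 * D ^ 4 = (M * D) ^ 2 * (8 * D ^ 2) by ring,
          ENNReal.ofReal_mul (p := (M * D) ^ 2) (by positivity)]
        ring

end IsMesh

/-! ### The error of the discrete multiplication operator -/

theorem normL2_sq (Ω : Set Plane) (f : Plane → ℝ) :
    normL2 Ω f ^ 2 = ∫⁻ x in Ω, ‖f x‖ₑ ^ 2 := by
  have h := eLpNorm_nnreal_pow_eq_lintegral (f := f) (μ := volume.restrict Ω) (p := 2) two_ne_zero
  unfold normL2
  norm_num at h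
  exact_mod_cast h

theorem enorm_setIntegral_mul_le {Ω : Set Plane} {w v : Plane → ℝ}
    (hw : AEStronglyMeasurable w (volume.restrict Ω))
    (hv : AEStronglyMeasurable v (volume.restrict Ω)) :
    ‖∫ x in Ω, w x * v x‖ₑ ≤ normL2 Ω w * normL2 Ω v := by
  refine (ENNReal.pow_le_pow_left_iff two_ne_zero).1 ?_
  rw [mul_pow, normL2_sq, normL2_sq]
  refine le_trans (pow_le_pow_left' (enorm_integral_le_lintegral_enorm _) 2) ?_
  simp only [enorm_mul]
  exact sq_lintegral_mul_le hw.enorm hv.enorm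

theorem MemSobolev.integrableOn {Ω : Set Plane} (hb : Bornology.IsBounded Ω) {m : ℕ}
    {f : Plane → ℝ} (hf : MemSobolev Ω m ⊤ f) : IntegrableOn f Ω := by
  have : IsFiniteMeasure (volume.restrict Ω) := ⟨by
    rw [Measure.restrict_apply_univ]; exact hb.measure_lt_top⟩
  exact hf.1.integrable le_top

theorem MemSobolev.mono_order {Ω : Set Plane} {m m' : ℕ} (h : m' ≤ m) {q : ℝ≥0∞} {f : Plane → ℝ}
    (hf : MemSobolev Ω m q f) : MemSobolev Ω m' q f :=
  ⟨hf.1, fun α hα => hf.2 α (hα.trans h)⟩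

namespace IsMesh

variable {Ω : Set Plane} {T : Finset (Finset Plane)} {D : ℝ} {a : ℝ≥0∞} {u ρ : Plane → ℝ}

theorem mem_interiorNodes {T : Finset (Finset Plane)} {P : Plane} :
    P ∈ interiorNodes Ω T ↔ (∃ s ∈ T, P ∈ s) ∧ P ∈ Ω := by
  classical
  simp [interiorNodes]

theorem eq_sum_nodalBasis (hT : IsMesh Ω T D a) (hΩ : IsOpen Ω) (hu : MemV Ω T u) {x : Plane}
    (hx : x ∈ closure Ω) : u x = ∑ P ∈ interiorNodes Ω T, u P * nodalBasis T P x := by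
  classical
  obtain ⟨s, hs, hxs⟩ := hT.exists_mem_triangle hx
  obtain ⟨A, hA⟩ := hu.2.1 s hs
  have h1 : u x = ∑ P ∈ s, u P * nodalBasis T P x := by
    rw [hA hxs, (hT.isCell s hs).affine_apply A x]
    refine Finset.sum_congr rfl fun P hP => ?_
    rw [hT.nodalBasis_eq hs hxs, hA (IsCell.subset_triangle s hP), mul_comm]
  rw [h1, ← Finset.sum_subset (Finset.inter_subset_left (s₁ := s) (s₂ := interiorNodes Ω T)),
    ← Finset.sum_subset (Finset.inter_subset_right (s₁ := s) (s₂ := interiorNodes Ω T))]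
  · intro P hP hPs
    have : P ∉ s := fun h => hPs (Finset.mem_inter.2 ⟨h, hP⟩)
    rw [hT.nodalBasis_eq hs hxs, baryCoord_of_notMem this, mul_zero]
  · intro P hP hPN
    have hPΩ : P ∉ Ω := fun h =>
      hPN (Finset.mem_inter.2 ⟨hP, mem_interiorNodes.2 ⟨⟨s, hs, hP⟩, h⟩⟩)
    have hPf : P ∈ frontier Ω := by
      rw [hΩ.frontier_eq]
      exact ⟨hT.triangle_subset_closure hs (IsCell.subset_triangle s hP), hPΩ⟩
    rw [hu.2.2 P hPf, zero_mul]

theorem interp_node (hT : IsMesh Ω T D a) {P : Plane} (hP : P ∈ interiorNodes Ω T)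
    (f : Plane → ℝ) : interp Ω T f P = f P := by
  classical
  obtain ⟨⟨s, hs, hPs⟩, -⟩ := mem_interiorNodes.1 hP
  unfold interp
  simp only [hT.nodalBasis_node hs hPs, mul_ite, mul_one, mul_zero]
  rw [Finset.sum_ite_eq', if_pos hP]

/-- The error of the discrete multiplication operator. -/
noncomputable def mulError (Ω : Set Plane) (T : Finset (Finset Plane)) (ρ u : Plane → ℝ) :
    Plane → ℝ :=
  mulOp ρ u - discreteMulOp Ω T (interp Ω T ρ) u

/-- The inner interpolation is invisible, because the outer one samples it at interior nodes only.
Boundary values of `u` vanish, so interior nodes also suffice to expand `u`. -/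
theorem mulError_eq (hT : IsMesh Ω T D a) (hΩ : IsOpen Ω) (hu : MemV Ω T u) {x : Plane}
    (hx : x ∈ closure Ω) : mulError Ω T ρ u x =
      ∑ P ∈ interiorNodes Ω T, u P * nodalBasis T P x * (ρ x - ρ P) := by
  have h1 : discreteMulOp Ω T (interp Ω T ρ) u x =
      ∑ P ∈ interiorNodes Ω T, ρ P * u P * nodalBasis T P x := by
    refine Finset.sum_congr rfl fun P hP => ?_
    rw [mulOp, hT.interp_node hP]
  rw [mulError, Pi.sub_apply, h1, mulOp, hT.eq_sum_nodalBasis hΩ hu hx, Finset.mul_sum,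
    ← Finset.sum_sub_distrib]
  exact Finset.sum_congr rfl fun P _ => by ring

theorem continuousOn_mulError (hT : IsMesh Ω T D a) (hu : MemV Ω T u) (hρ : ContinuousOn ρ Ω) :
    ContinuousOn (mulError Ω T ρ u) Ω := by
  refine (hρ.mul (hu.1.mono subset_closure)).sub ?_
  exact continuousOn_finsetSum _ fun P _ =>
    continuousOn_const.mul ((hT.continuousOn_nodalBasis P).mono subset_closure)

theorem abs_nodal_sum_le (hT : IsMesh Ω T D a) {s : Finset Plane} (hs : s ∈ T) {x : Plane}
    (hx : x ∈ triangle s) {m R : ℝ} (hm : 0 ≤ m) (hR : 0 ≤ R) (hu : ∀ P ∈ s, |u P| ≤ m)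
    (N : Finset Plane) {r : Plane → ℝ} (hr : ∀ P ∈ N, P ∈ s → |r P| ≤ R) :
    |∑ P ∈ N, u P * nodalBasis T P x * r P| ≤ R * m := by
  classical
  have hc := hT.isCell s hs
  calc |∑ P ∈ N, u P * nodalBasis T P x * r P|
      ≤ ∑ P ∈ N, |u P * nodalBasis T P x * r P| := Finset.abs_sum_le_sum_abs _ _
    _ = ∑ P ∈ N ∩ s, |u P * nodalBasis T P x * r P| := by
        refine (Finset.sum_subset Finset.inter_subset_left fun P hP hPs => ?_).symm
        have : P ∉ s := fun h => hPs (Finset.mem_inter.2 ⟨hP, h⟩)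
        rw [hT.nodalBasis_eq hs hx, baryCoord_of_notMem this]
        simp
    _ ≤ ∑ P ∈ N ∩ s, baryCoord s P x * (R * m) := by
        refine Finset.sum_le_sum fun P hP => ?_
        obtain ⟨hPN, hPs⟩ := Finset.mem_inter.1 hP
        rw [hT.nodalBasis_eq hs hx, abs_mul, abs_mul, abs_of_nonneg (hc.baryCoord_nonneg hx P)]
        calc |u P| * baryCoord s P x * |r P| ≤ m * baryCoord s P x * R := by
              have := hc.baryCoord_nonneg hx P
              gcongr
              · exact hu P hPs
              · exact hr P hPN hPs
          _ = _ := by ring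
    _ ≤ ∑ P ∈ s, baryCoord s P x * (R * m) :=
        Finset.sum_le_sum_of_subset_of_nonneg Finset.inter_subset_right fun P _ _ =>
          mul_nonneg (hc.baryCoord_nonneg hx P) (by positivity)
    _ = R * m := by rw [← Finset.sum_mul, hc.sum_baryCoord, one_mul]

/-- A segment from a vertex to an interior point of a triangle runs in the interior except at the
vertex. This replaces convexity of `Ω` in the Lipschitz and Taylor bounds. -/
theorem segment_subset (hT : IsMesh Ω T D a) (hΩ : interior (closure Ω) = Ω) {s : Finset Plane}
    (hs : s ∈ T) {x P : Plane} (hx : x ∈ interior (triangle s)) (hP : P ∈ s) (hPΩ : P ∈ Ω) :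
    segment ℝ P x ⊆ Ω := by
  have hsub := hT.interior_triangle_subset hΩ hs
  rw [← insert_endpoints_openSegment]
  refine Set.insert_subset hPΩ (Set.insert_subset (hsub hx) (Set.Subset.trans ?_ hsub))
  exact (IsCell.convex_triangle s).openSegment_self_interior_subset_interior
    (IsCell.subset_triangle s hP) hx

theorem norm_sub_vertex_le (hT : IsMesh Ω T D a) {s : Finset Plane} (hs : s ∈ T) {x P : Plane}
    (hx : x ∈ triangle s) (hP : P ∈ s) : ‖x - P‖ ≤ D := by
  rw [← dist_eq_norm]
  exact IsCell.dist_le s (hT.dist_le s hs) hx (IsCell.subset_triangle s hP)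

theorem normL2_le_of_lintegral {w : Plane → ℝ} {R : ℝ} (hR : 0 ≤ R)
    (h : ∫⁻ x in Ω, ‖w x‖ₑ ^ 2 ≤ ENNReal.ofReal (64 * R ^ 2) * ∫⁻ x in Ω, ‖u x‖ₑ ^ 2) :
    normL2 Ω w ≤ ENNReal.ofReal (8 * R) * normL2 Ω u := by
  refine (ENNReal.pow_le_pow_left_iff two_ne_zero).1 ?_
  rw [mul_pow, normL2_sq, normL2_sq, ← ENNReal.ofReal_pow (by positivity)]
  convert! h using 3
  ring

theorem normL2_mulError_le (hT : IsMesh Ω T D a) (hΩ : interior (closure Ω) = Ω)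
    (hD : 0 ≤ D) (hu : MemV Ω T u) (hρ : IntegrableOn ρ Ω) (hc : ContinuousOn ρ Ω) {M : ℝ}
    (hM : 0 ≤ M) (h1 : WeakDerivBound Ω 1 ρ M) :
    normL2 Ω (mulError Ω T ρ u) ≤ ENNReal.ofReal (16 * M * D) * normL2 Ω u := by
  have hΩo : IsOpen Ω := hΩ ▸ isOpen_interior
  have hR : 0 ≤ 2 * M * D := by positivity
  rw [show 16 * M * D = 8 * (2 * M * D) by ring]
  refine normL2_le_of_lintegral hR (hT.lintegral_sq_le hΩ hu.2.1 fun s hs x hx m hm hum => ?_)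
  have hxs := interior_subset hx
  rw [hT.mulError_eq hΩo hu (hT.triangle_subset_closure hs hxs)]
  refine hT.abs_nodal_sum_le hs hxs hm hR hum _ fun P hP hPs => ?_
  refine (h1.abs_sub_le hΩo hρ hc hM (hT.segment_subset hΩ hs hx hPs
    (mem_interiorNodes.1 hP).2)).trans ?_
  gcongr
  exact hT.norm_sub_vertex_le hs hxs hPs

/-! ### The linear part of the error -/

/-- The part of the error that is linear in the displacement from the nodes. -/
noncomputable def linearError (Ω : Set Plane) (T : Finset (Finset Plane))
    (L : Plane → Plane →L[ℝ] ℝ) (u : Plane → ℝ) (x : Plane) : ℝ :=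
  ∑ P ∈ interiorNodes Ω T, u P * nodalBasis T P x * L P (x - P)

theorem continuousOn_linearError (hT : IsMesh Ω T D a) (L : Plane → Plane →L[ℝ] ℝ) :
    ContinuousOn (linearError Ω T L u) (closure Ω) :=
  continuousOn_finsetSum _ fun P _ =>
    (continuousOn_const.mul (hT.continuousOn_nodalBasis P)).mul (by fun_prop)

theorem normL2_mulError_sub_linearError_le (hT : IsMesh Ω T D a)
    (hΩ : interior (closure Ω) = Ω) (hu : MemV Ω T u) {M : ℝ} (hM : 0 ≤ M)
    {L : Plane → Plane →L[ℝ] ℝ} (hL : ∀ P ∈ Ω, ∀ x, segment ℝ P x ⊆ Ω →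
      |ρ x - ρ P - L P (x - P)| ≤ 4 * M * ‖x - P‖ ^ 2) :
    normL2 Ω (mulError Ω T ρ u - linearError Ω T L u) ≤
      ENNReal.ofReal (32 * M * D ^ 2) * normL2 Ω u := by
  have hΩo : IsOpen Ω := hΩ ▸ isOpen_interior
  have hR : 0 ≤ 4 * M * D ^ 2 := by positivity
  rw [show 32 * M * D ^ 2 = 8 * (4 * M * D ^ 2) by ring]
  refine normL2_le_of_lintegral hR (hT.lintegral_sq_le hΩ hu.2.1 fun s hs x hx m hm hum => ?_)
  have hxs := interior_subset hx
  rw [Pi.sub_apply, hT.mulError_eq hΩo hu (hT.triangle_subset_closure hs hxs), linearError,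
    ← Finset.sum_sub_distrib]
  simp only [← mul_sub]
  refine hT.abs_nodal_sum_le hs hxs hm hR hum _ fun P hP hPs => ?_
  have hPΩ := (mem_interiorNodes.1 hP).2
  refine (hL P hPΩ x (hT.segment_subset hΩ hs hx hPs hPΩ)).trans ?_
  gcongr
  exact hT.norm_sub_vertex_le hs hxs hPs

theorem enorm_integral_linearError_le (hT : IsMesh Ω T D a) (hΩ : interior (closure Ω) = Ω)
    (hD : 0 ≤ D) {K : ℝ} (hK : 0 ≤ K)
    (hKD : ∀ G : Plane → ℝ≥0∞, Measurable G →
      ∑ P ∈ interiorNodes Ω T, ∫⁻ x in square P D, G x ≤ ENNReal.ofReal K * ∫⁻ x, G x)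
    (hsym : IsLocallySymmetric Ω T) (hu : MemV Ω T u) {M : ℝ} (hM : 0 ≤ M)
    {L : Plane → Plane →L[ℝ] ℝ} (hL : ∀ P ∈ Ω, ‖L P‖ ≤ 2 * M) {φ : Plane → ℝ}
    (hφ : IsTestFunction Ω φ) (hφ2 : ∀ j, normL2 Ω (partialDeriv j φ) ≤ 2) :
    ‖∫ x in Ω, linearError Ω T L u x * φ x‖ₑ ≤
      ENNReal.ofReal ((12288 * K + 1) * M * D ^ 2) * normL2 Ω u := by
  have e1 : ∫ x in Ω, linearError Ω T L u x * φ x =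
      ∑ P ∈ interiorNodes Ω T, u P * ∫ x, nodalBasis T P x * (L P (x - P) * φ x) := by
    -- As `φ` vanishes off `Ω`, the integral may be taken over the whole plane, which every point
    -- reflection preserves.
    rw [hφ.setIntegral_mul_eq]
    have hc := hφ.continuous
    simp only [← integral_const_mul]
    rw [← integral_finsetSum]
    · refine integral_congr_ae (Filter.Eventually.of_forall fun x => ?_)
      simp only [linearError]
      rw [Finset.sum_mul]
      exact Finset.sum_congr rfl fun P _ => by ring
    · exact fun P _ => (hT.integrable_nodalBasis_mul P (by fun_prop)).const_mul _
  let G : Plane → ℝ≥0∞ := fun x => ‖partialDeriv 0 φ x‖ₑ ^ 2 + ‖partialDeriv 1 φ x‖ₑ ^ 2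
  have hGm (j : Fin 2) : Measurable fun x => ‖partialDeriv j φ x‖ₑ ^ 2 :=
    (hφ.partialDeriv j).continuous.measurable.enorm.pow_const 2
  have hGj (j : Fin 2) : ∫⁻ x, ‖partialDeriv j φ x‖ₑ ^ 2 ≤ 4 := by
    have h1 : ∫⁻ x, ‖partialDeriv j φ x‖ₑ ^ 2 = ∫⁻ x in Ω, ‖partialDeriv j φ x‖ₑ ^ 2 := by
      refine (setLIntegral_eq_of_support_subset fun x hx => ?_).symm
      by_contra h
      exact hx (by simp [(hφ.partialDeriv j).eq_zero h])
    rw [h1, ← normL2_sq]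
    refine (pow_le_pow_left' (hφ2 j) 2).trans ?_
    norm_num
  have hG : ∫⁻ x, G x ≤ 8 := by
    rw [lintegral_add_left (hGm 0)]
    refine (add_le_add (hGj 0) (hGj 1)).trans ?_
    norm_num
  refine (ENNReal.pow_le_pow_left_iff two_ne_zero).1 ?_
  calc ‖∫ x in Ω, linearError Ω T L u x * φ x‖ₑ ^ 2
      ≤ (∑ P ∈ interiorNodes Ω T,
          ‖u P‖ₑ * ‖∫ x, nodalBasis T P x * (L P (x - P) * φ x)‖ₑ) ^ 2 := by
        rw [e1]
        refine pow_le_pow_left' ((enorm_sum_le _ _).trans (le_of_eq ?_)) 2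
        simp only [enorm_mul]
    _ ≤ (∑ P ∈ interiorNodes Ω T, ‖u P‖ₑ ^ 2 * volume (star T P)) *
          ∑ P ∈ interiorNodes Ω T,
            ENNReal.ofReal (8 * M ^ 2 * D ^ 4) * ∫⁻ x in square P D, G x :=
        sq_sum_mul_le_of_sq_le _ _ _ _ _ fun P hP => hT.enorm_integral_moment_sq_le (hsym P hP)
          hφ.contDiff_one (hL P (mem_interiorNodes.1 hP).2) hM hD
    _ ≤ (192 * normL2 Ω u ^ 2) * (ENNReal.ofReal (8 * M ^ 2 * D ^ 4) *
          (ENNReal.ofReal K * 8)) := by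
        rw [← Finset.mul_sum, normL2_sq]
        refine mul_le_mul' (hT.sum_sq_mul_volume_star_le hΩ hu.2.1 _) (mul_le_mul' le_rfl ?_)
        exact (hKD G ((hGm 0).add (hGm 1))).trans (mul_le_mul' le_rfl hG)
    _ = ENNReal.ofReal (12288 * K * (M * D ^ 2) ^ 2) * normL2 Ω u ^ 2 := by
        rw [show 12288 * K * (M * D ^ 2) ^ 2 = 192 * ((8 * M ^ 2 * D ^ 4) * (K * 8)) by ring,
          ENNReal.ofReal_mul (p := 192) (by norm_num),
          ENNReal.ofReal_mul (p := 8 * M ^ 2 * D ^ 4) (by positivity), ENNReal.ofReal_mul hK]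
        simp only [ENNReal.ofReal_ofNat]
        ring
    -- Bounding 12288K by (12288K + 1)² avoids a square root in the constant.
    _ ≤ _ := by
        rw [mul_pow (ENNReal.ofReal _), ← ENNReal.ofReal_pow (by positivity)]
        refine mul_le_mul' (ENNReal.ofReal_le_ofReal ?_) le_rfl
        rw [mul_assoc (12288 * K + 1), mul_pow (12288 * K + 1)]
        gcongr
        nlinarith

/-! ### The two estimates in the dual norm -/

theorem isFiniteMeasure_restrict (hT : IsMesh Ω T D a) :
    IsFiniteMeasure ((volume : Measure Plane).restrict Ω) := ⟨by
  rw [Measure.restrict_apply_univ]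
  exact (measure_mono subset_closure).trans_lt hT.isCompact_closure.measure_lt_top⟩

theorem memLp_of_continuousOn_closure (hT : IsMesh Ω T D a) (hΩ : IsOpen Ω) {f : Plane → ℝ}
    (hf : ContinuousOn f (closure Ω)) : MemLp f 2 (volume.restrict Ω) := by
  have := hT.isFiniteMeasure_restrict
  obtain ⟨C, hC⟩ := hT.isCompact_closure.exists_bound_of_continuousOn hf
  refine MemLp.of_bound ((hf.mono subset_closure).aestronglyMeasurable hΩ.measurableSet) C ?_
  rw [ae_restrict_iff' hΩ.measurableSet]
  exact Filter.Eventually.of_forall fun x hx => hC x (subset_closure hx)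

theorem normHNegTilde_mulError_le_one (hT : IsMesh Ω T D a) (hΩ : interior (closure Ω) = Ω)
    (hD : 0 ≤ D) (hu : MemV Ω T u) (hρ : IntegrableOn ρ Ω) (hc : ContinuousOn ρ Ω) {M : ℝ}
    (hM : 0 ≤ M) (h1 : WeakDerivBound Ω 1 ρ M) :
    normHNegTilde Ω 1 (mulError Ω T ρ u) ≤ ENNReal.ofReal (16 * M * D) * normL2 Ω u := by
  have hΩo : IsOpen Ω := hΩ ▸ isOpen_interior
  refine iSup₂_le fun v ⟨hv, _, hv1⟩ => ?_
  rw [← Real.norm_eq_abs, ofReal_norm]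
  refine (enorm_setIntegral_mul_le
    ((hT.continuousOn_mulError hu hc).aestronglyMeasurable hΩo.measurableSet)
    hv.1.aestronglyMeasurable).trans ?_
  refine (mul_le_mul' (hT.normL2_mulError_le hΩ hD hu hρ hc hM h1)
    (normL2_le_one hΩo hv hv1)).trans ?_
  rw [mul_one]

/-- With e the error, l its linear part and φ a test function near v, the pairing is split as ∫ev =
∫e(v - φ) + ∫(e - l)φ + ∫lφ. The terms contribute 16, 64 and 12288K + 1 to the constant. -/
theorem normHNegTilde_mulError_le_two (hT : IsMesh Ω T D a) (hΩ : interior (closure Ω) = Ω)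
    (hD : 0 < D) {K : ℝ} (hK : 0 ≤ K)
    (hKD : ∀ G : Plane → ℝ≥0∞, Measurable G →
      ∑ P ∈ interiorNodes Ω T, ∫⁻ x in square P D, G x ≤ ENNReal.ofReal K * ∫⁻ x, G x)
    (hsym : IsLocallySymmetric Ω T) (hu : MemV Ω T u) (hρ : IntegrableOn ρ Ω)
    (hc : ContinuousOn ρ Ω) {M : ℝ} (hM : 0 ≤ M) (h1 : WeakDerivBound Ω 1 ρ M)
    (h2 : WeakDerivBound Ω 2 ρ M) :
    normHNegTilde Ω 1 (mulError Ω T ρ u) ≤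
      ENNReal.ofReal ((12288 * K + 81) * M * D ^ 2) * normL2 Ω u := by
  have hΩo : IsOpen Ω := hΩ ▸ isOpen_interior
  refine iSup₂_le fun v ⟨hv, hv0, hv1⟩ => ?_
  rw [← Real.norm_eq_abs, ofReal_norm]
  have hL : ∀ P, ∃ L : Plane →L[ℝ] ℝ, P ∈ Ω → ‖L‖ ≤ 2 * M ∧ ∀ x, segment ℝ P x ⊆ Ω →
      |ρ x - ρ P - L (x - P)| ≤ 4 * M * ‖x - P‖ ^ 2 := by
    intro P
    by_cases hP : P ∈ Ω
    · obtain ⟨L, hL⟩ := h1.exists_taylor hΩo hρ hc hM h2 hP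
      exact ⟨L, fun _ => hL⟩
    · exact ⟨0, fun h => absurd h hP⟩
  choose L hL using hL
  set e := mulError Ω T ρ u with he
  set l := linearError Ω T L u with hl
  -- Tolerance at most 1 bounds φ and its partial derivatives by 2 in L²; tolerance at most D turns
  -- the first-order bound for e into a second-order bound for ∫e(v - φ).
  have hε : 0 < ENNReal.ofReal (min 1 D) := by
    rw [ENNReal.ofReal_pos]; exact lt_min one_pos hD
  have hε1 : ENNReal.ofReal (min 1 D) ≤ 1 := by
    rw [← ENNReal.ofReal_one]; exact ENNReal.ofReal_le_ofReal (min_le_left _ _)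
  have hεD : ENNReal.ofReal (min 1 D) ≤ ENNReal.ofReal D :=
    ENNReal.ofReal_le_ofReal (min_le_right _ _)
  obtain ⟨φ, hφ, hvφ, hdφ⟩ := exists_testFunction_approx hΩo hv0 hv1 hε
  have hφL2 : MemLp φ 2 (volume.restrict Ω) := (hφ.memLp 2).restrict Ω
  have hem : AEStronglyMeasurable e (volume.restrict Ω) :=
    (hT.continuousOn_mulError hu hc).aestronglyMeasurable hΩo.measurableSet
  have heN : normL2 Ω e ≤ ENNReal.ofReal (16 * M * D) * normL2 Ω u :=
    hT.normL2_mulError_le hΩ hD.le hu hρ hc hM h1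
  have huL2 := hT.memLp_of_continuousOn_closure hΩo hu.1
  have heL2 : MemLp e 2 (volume.restrict Ω) :=
    ⟨hem, heN.trans_lt (ENNReal.mul_lt_top ENNReal.ofReal_lt_top huL2.2)⟩
  have hlL2 : MemLp l 2 (volume.restrict Ω) :=
    hT.memLp_of_continuousOn_closure hΩo (hT.continuousOn_linearError L)
  have hφ2 : normL2 Ω φ ≤ 2 := by
    calc normL2 Ω φ = normL2 Ω (v - (v - φ)) := by congr 1; abel
      _ ≤ normL2 Ω v + normL2 Ω (v - φ) := eLpNorm_sub_le hv.1.1 (hv.1.1.sub hφL2.1) (by norm_num)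
      _ ≤ 1 + 1 := add_le_add (normL2_le_one hΩo hv hv1) (hvφ.trans hε1)
      _ = 2 := by norm_num
  have split : ∫ x in Ω, e x * v x =
      (∫ x in Ω, e x * (v - φ) x) + (∫ x in Ω, (e - l) x * φ x) + ∫ x in Ω, l x * φ x := by
    have i1 : Integrable (fun x => e x * (v - φ) x) (volume.restrict Ω) :=
      heL2.integrable_mul (hv.1.sub hφL2)
    have i2 : Integrable (fun x => (e - l) x * φ x) (volume.restrict Ω) :=
      (heL2.sub hlL2).integrable_mul hφL2
    have i3 : Integrable (fun x => l x * φ x) (volume.restrict Ω) := hlL2.integrable_mul hφL2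
    have i12 : Integrable (fun x => e x * (v - φ) x + (e - l) x * φ x) (volume.restrict Ω) :=
      i1.add i2
    rw [← integral_add i1 i2, ← integral_add i12 i3]
    refine integral_congr_ae (Filter.Eventually.of_forall fun x => ?_)
    simp only [Pi.sub_apply]
    ring
  have b1 : ‖∫ x in Ω, e x * (v - φ) x‖ₑ ≤ ENNReal.ofReal (16 * M * D ^ 2) * normL2 Ω u := by
    refine (enorm_setIntegral_mul_le hem (hv.1.1.sub hφL2.1)).trans
      ((mul_le_mul' heN (hvφ.trans hεD)).trans (le_of_eq ?_))
    rw [show 16 * M * D ^ 2 = (16 * M * D) * D by ring,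
      ENNReal.ofReal_mul (p := 16 * M * D) (by positivity)]
    ring
  have b2 : ‖∫ x in Ω, (e - l) x * φ x‖ₑ ≤ ENNReal.ofReal (64 * M * D ^ 2) * normL2 Ω u := by
    refine (enorm_setIntegral_mul_le (hem.sub hlL2.1) hφL2.1).trans
      ((mul_le_mul' (hT.normL2_mulError_sub_linearError_le hΩ hu hM
        fun P hP => (hL P hP).2) hφ2).trans (le_of_eq ?_))
    rw [show 64 * M * D ^ 2 = (32 * M * D ^ 2) * 2 by ring,
      ENNReal.ofReal_mul (p := 32 * M * D ^ 2) (by positivity),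
      ENNReal.ofReal_ofNat]
    ring
  have b3 := hT.enorm_integral_linearError_le hΩ hD.le hK hKD hsym hu hM
    (fun P hP => (hL P hP).1) hφ fun j => (hdφ j).trans
      ((add_le_add le_rfl hε1).trans (by norm_num))
  rw [split]
  refine (enorm_add_le _ _).trans ((add_le_add ((enorm_add_le _ _).trans (add_le_add b1 b2))
    b3).trans (le_of_eq ?_))
  rw [← add_mul, ← add_mul, ← ENNReal.ofReal_add (by positivity) (by positivity),
    ← ENNReal.ofReal_add (by positivity) (by positivity)]
  congr 2
  ring

/-- The overlap constant depends on a mesh only through D² divided by the area bound, and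
(D/2^k)²/(a₀/4^k) does not depend on `k`. -/
theorem sum_lintegral_square_mesh_le {a₀ : ℝ} (ha₀ : 0 < a₀)
    (hT : IsMesh Ω T D (ENNReal.ofReal a₀)) (hD : 0 ≤ D) (k : ℕ) {G : Plane → ℝ≥0∞}
    (hG : Measurable G) :
    ∑ P ∈ interiorNodes Ω (FEM.mesh T k), ∫⁻ x in square P (D / 2 ^ k), G x ≤
      ENNReal.ofReal (27 * D ^ 2 / a₀ * (volume (Metric.ball (0 : Plane) 1)).toReal) *
        ∫⁻ x, G x := by
  have h := (hT.mesh k).mul_sum_lintegral_square_le (by positivity)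
    (N := interiorNodes Ω (FEM.mesh T k)) (fun P hP => (mem_interiorNodes.1 hP).1) hG
  have hB : volume (Metric.ball (0 : Plane) 1) ≠ ⊤ := measure_ball_lt_top.ne
  have e1 : ENNReal.ofReal a₀ / 4 ^ k = ENNReal.ofReal (a₀ / 4 ^ k) := by
    rw [ENNReal.ofReal_div_of_pos (by positivity), ENNReal.ofReal_pow (by norm_num),
      ENNReal.ofReal_ofNat]
  have hpos : 0 < a₀ / 4 ^ k := by positivity
  have h4 : ENNReal.ofReal (a₀ / 4 ^ k) ≠ 0 := (ENNReal.ofReal_pos.2 hpos).ne'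
  rw [e1] at h
  refine (ENNReal.mul_le_mul_iff_right h4 ENNReal.ofReal_ne_top).1 (h.trans (le_of_eq ?_))
  rw [ENNReal.ofReal_mul (p := 27 * D ^ 2 / a₀) (by positivity), ENNReal.ofReal_toReal hB,
    ← mul_assoc, ← mul_assoc,
    ← ENNReal.ofReal_mul hpos.le]
  congr 3
  have : ((2 : ℝ) ^ k) ^ 2 = 4 ^ k := by rw [← pow_mul, mul_comm, pow_mul]; norm_num
  field_simp
  rw [this]

end IsMesh

/-! ### Assembly, with a constant fixed by the initial mesh -/

theorem meshSize_pos {Ω : Set Plane} (hΩ : IsPolygonalDomain Ω) {T : Finset (Finset Plane)}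
    (hT : IsTriangulation Ω T) : 0 < meshSize T := by
  obtain ⟨a, -, hm⟩ := hT.isMesh
  obtain ⟨x, hx⟩ := hΩ.isConnected.nonempty
  obtain ⟨s, hs, -⟩ := hm.exists_mem_triangle (subset_closure hx)
  obtain ⟨p, q, r, hpq, -, -, h⟩ := (hm.isCell s hs).exists_triple
  exact (dist_pos.2 hpq).trans_le (dist_le_meshSize hs ((h p).2 (by simp)) ((h q).2 (by simp)))

end FEM

theorem lemma4p7 (Ω : Set FEM.Plane) (hΩ : FEM.IsPolygonalDomain Ω)
    (T₀ : Finset (Finset FEM.Plane)) (hT₀ : FEM.IsTriangulation Ω T₀) :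
    ∃ C : ℝ, 0 < C ∧
      ∀ ρ : FEM.Plane → ℝ, FEM.MemSobolev Ω 2 ⊤ ρ → ContinuousOn ρ Ω →
      ∀ (k : ℕ) (h : ℝ), h = FEM.meshSize T₀ / 2 ^ k →
      ∀ u : FEM.Plane → ℝ, FEM.MemV Ω (FEM.mesh T₀ k) u →
        (FEM.IsLocallySymmetric Ω (FEM.mesh T₀ k) →
          FEM.normHNegTilde Ω 1
              (FEM.mulOp ρ u -
                FEM.discreteMulOp Ω (FEM.mesh T₀ k) (FEM.interp Ω (FEM.mesh T₀ k) ρ) u) ≤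
            ENNReal.ofReal (C * h ^ 2) * FEM.normWInftyModConst Ω 2 ρ * FEM.normL2 Ω u) ∧
        FEM.normHNegTilde Ω 1
            (FEM.mulOp ρ u -
              FEM.discreteMulOp Ω (FEM.mesh T₀ k) (FEM.interp Ω (FEM.mesh T₀ k) ρ) u) ≤
          ENNReal.ofReal (C * h) * FEM.normWInftyModConst Ω 1 ρ * FEM.normL2 Ω u := by
  obtain ⟨a₀, ha₀, hmesh⟩ := hT₀.isMesh
  have hh := FEM.meshSize_pos hΩ hT₀
  set K := 27 * FEM.meshSize T₀ ^ 2 / a₀ *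
    (volume (Metric.ball (0 : FEM.Plane) 1)).toReal with hKdef
  have hK : 0 ≤ K := by positivity
  -- The constant of the second-order bound; it exceeds the 16 needed for the first-order bound.
  refine ⟨12288 * K + 81, by positivity, ?_⟩
  intro ρ hρ hc k h hhk u hu
  have hD : 0 < FEM.meshSize T₀ / 2 ^ k := by positivity
  have hmk := hmesh.mesh k
  rw [← hhk] at hmk hD
  have hint := hρ.integrableOn hΩ.isBounded
  have hcl := hΩ.interior_closure
  constructor
  · intro hsym
    refine (hmk.normHNegTilde_mulError_le_two hcl hD hK (fun G hG => ?_) hsym hu hint hc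
      ENNReal.toReal_nonneg (hρ.weakDerivBound hΩ.isOpen le_rfl one_le_two)
      (hρ.weakDerivBound hΩ.isOpen one_le_two le_rfl)).trans (le_of_eq ?_)
    · rw [hhk]
      exact FEM.IsMesh.sum_lintegral_square_mesh_le ha₀ hmesh hh.le k hG
    · rw [mul_right_comm, ENNReal.ofReal_mul (by positivity), ENNReal.ofReal_toReal
        (FEM.normWInftyModConst_lt_top hΩ.isOpen hρ).ne]
  · have hρ1 := hρ.mono_order one_le_two
    refine (hmk.normHNegTilde_mulError_le_one hcl hD.le hu hint hc ENNReal.toReal_nonneg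
      (hρ1.weakDerivBound hΩ.isOpen le_rfl le_rfl)).trans (mul_le_mul' ?_ le_rfl)
    rw [mul_right_comm, ENNReal.ofReal_mul (by positivity), ENNReal.ofReal_toReal
        (FEM.normWInftyModConst_lt_top hΩ.isOpen hρ1).ne]
    gcongr
    linarith
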